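/- Let $(E_i)_{i\ge 1}$ be a sequence of finite sets whose cardinalities $|E_i|$ are bounded. Let $X^n=E_1\times\cdots\times E_n$, let $X^*=\bigsqcup_{n\ge 0}X^n$ be the rooted tree of finite words (in which $v\in X^n$ is joined to $ve$ for every $e\in E_{n+1}$), and let $X^\omega=\prod_{i\ge 1}E_i$ be its boundary, with the product topology of the discrete sets $E_i$. For $g\in\operatorname{Aut}(X^*)$ and $v\in X^n$ the section $g|_v$ is the automorphism of the tree of the sequence $(E_{n+1},E_{n+2},\ldots)$ defined by $g(vw)=g(v)\,g|_v(w)$. An automorphism $h$ is finitary if for some $n$ all its sections at vertices of level $n$ are trivial; the least such $n$ is the depth of $h$. An automorphism $g$ is bounded if the number of $v\in X^n$ with $g|_v\neq 1$ is bounded uniformly in $n$. Let $G\le\operatorname{Aut}(X^*)$ be a group generated by a (not necessarily finite) set $S$ of bounded automorphisms, such that for every $g\in S$ there is a number $n$ (depending on $g$) with the property that every section $g|_v$, $v\in X^*$, that is finitary has depth less than $n$. Then for every $w\in X^\omega$ the group of germs $\mathfrak{G}_w$, that is, the quotient of the stabilizer $G_w$ by the subgroup of those elements that act trivially on a neighbourhood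 of $w$, is locally finite (all its finitely generated subgroups are finite). Moreover, the group $G$ is amenable. -/

import Mathlib

open scoped Topology

universe u

/-! ### Rooted trees of finite words, their automorphisms and sections

`E i` (with `i` starting at `0`) is the alphabet of the `(i+1)`-st letter. -/

/-- The `n`-th level of the rooted tree of the sequence of alphabets `E`. -/
abbrev Word (E : ℕ → Type u) (n : ℕ) : Type u := (i : Fin n) → E i

/-- The sequence of alphabets with the first `n` of them removed. -/
abbrev shiftSeq (E : ℕ → Type u) (n : ℕ) : ℕ → Type u := fun i => E (n + i)

namespace Word

variable {E : ℕ → Type u}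

/-- The parent of a vertex of level `n + 1`: delete the last letter. -/
def parent {n : ℕ} (v : Word E (n + 1)) : Word E n := fun i => v i.castSucc

/-- The beginning of length `n` of a word of length `n + m`. -/
def left {n m : ℕ} (u : Word E (n + m)) : Word E n := fun i => u (Fin.castAdd m i)

/-- The last `m` letters of a word of length `n + m`. -/
def right {n m : ℕ} (u : Word E (n + m)) : Word (shiftSeq E n) m :=
  fun j => u (Fin.natAdd n j)

/-- The concatenation `v w`. -/
def append {n m : ℕ} (v : Word E n) (w : Word (shiftSeq E n) m) : Word E (n + m) :=
  fun i => Fin.addCases (motive := fun i : Fin (n + m) => E i) (fun i => v i) (fun j => w j) i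

@[simp] theorem left_append {n m : ℕ} (v : Word E n) (w : Word (shiftSeq E n) m) :
    (append v w).left = v := by
  funext i
  exact Fin.addCases_left (motive := fun i : Fin (n + m) => E i) i

@[simp] theorem right_append {n m : ℕ} (v : Word E n) (w : Word (shiftSeq E n) m) :
    (append v w).right = w := by
  funext i
  exact Fin.addCases_right (motive := fun i : Fin (n + m) => E i) i

@[simp] theorem append_left_right {n m : ℕ} (u : Word E (n + m)) :
    append u.left u.right = u := by
  funext i
  refine Fin.addCases (fun i => ?_) (fun j => ?_) i
  · exact Fin.addCases_left (motive := fun i : Fin (n + m) => E i) i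
  · exact Fin.addCases_right (motive := fun i : Fin (n + m) => E i) j

end Word

/-- The group of automorphisms of the rooted tree of words: an automorphism permutes every
level and preserves the relation between a vertex and its parent. -/
def treeAut (E : ℕ → Type u) : Subgroup ((n : ℕ) → Equiv.Perm (Word E n)) where
  carrier := {g | ∀ (n : ℕ) (v : Word E (n + 1)), (g (n + 1) v).parent = g n v.parent}
  one_mem' := fun _ _ => rfl
  mul_mem' := by
    intro a b ha hb n v
    change (a (n + 1) (b (n + 1) v)).parent = a n (b n v.parent)
    rw [ha, hb]
  inv_mem' := by
    intro a ha n v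
    change ((a (n + 1))⁻¹ v).parent = (a n)⁻¹ v.parent
    rw [Equiv.Perm.eq_inv_iff_eq, ← ha]
    exact congrArg Word.parent ((a (n + 1)).apply_symm_apply v)

/-- `Aut X^*`. -/
abbrev TreeAut (E : ℕ → Type u) : Type u := treeAut E

namespace TreeAut

variable {E : ℕ → Type u}

theorem left_apply (g : TreeAut E) {n : ℕ} : ∀ {m : ℕ} (u : Word E (n + m)),
    (g.1 (n + m) u).left = g.1 n u.left
  | 0, _ => rfl
  | m + 1, u => by
    have h := left_apply g (m := m) (Word.parent (n := n + m) u)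
    rw [← g.2 (n + m) u] at h
    exact h

theorem inv_apply_self (g : TreeAut E) (n : ℕ) (v : Word E n) :
    (g⁻¹).1 n (g.1 n v) = v :=
  (g.1 n).symm_apply_apply v

theorem apply_inv_self (g : TreeAut E) (n : ℕ) (v : Word E n) :
    g.1 n ((g⁻¹).1 n v) = v :=
  (g.1 n).apply_symm_apply v

/-- The map `w ↦ g|_v (w)` on words of length `m`: the word `g (v w)` with its first `n`
letters, which spell `g v`, removed. -/
def sectionFun (g : TreeAut E) {n : ℕ} (v : Word E n) (m : ℕ)
    (w : Word (shiftSeq E n) m) : Word (shiftSeq E n) m :=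
  (g.1 (n + m) (v.append w)).right

theorem append_sectionFun (g : TreeAut E) {n : ℕ} (v : Word E n) (m : ℕ)
    (w : Word (shiftSeq E n) m) :
    (g.1 n v).append (sectionFun g v m w) = g.1 (n + m) (v.append w) := by
  have h : g.1 n v = (g.1 (n + m) (v.append w)).left := by
    rw [left_apply, Word.left_append]
  rw [h, sectionFun, Word.append_left_right]

theorem sectionFun_inv (g : TreeAut E) {n : ℕ} (v : Word E n) (m : ℕ)
    (w : Word (shiftSeq E n) m) :
    sectionFun g⁻¹ (g.1 n v) m (sectionFun g v m w) = w := by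
  rw [sectionFun, append_sectionFun, inv_apply_self, Word.right_append]

/-- The section `g|_v`, an automorphism of the tree of the shifted sequence. -/
def sectionAt (g : TreeAut E) {n : ℕ} (v : Word E n) : TreeAut (shiftSeq E n) :=
  ⟨fun m =>
    { toFun := sectionFun g v m
      invFun := sectionFun g⁻¹ (g.1 n v) m
      left_inv := sectionFun_inv g v m
      right_inv := by
        intro w
        have h := sectionFun_inv g⁻¹ (g.1 n v) m w
        rwa [inv_apply_self, inv_inv] at h },
    by
      intro m w
      have h1 : Word.parent (n := n + m) (v.append w) = v.append w.parent := by
        have h : (Word.parent (n := n + m) (v.append w)) =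
            (Word.parent (n := n + m) (v.append w)).left.append
              (Word.parent (n := n + m) (v.append w)).right :=
          (Word.append_left_right _).symm
        rw [h]
        have hl : (Word.parent (n := n + m) (v.append w)).left = v :=
          Word.left_append v w
        have hr : (Word.parent (n := n + m) (v.append w)).right = w.parent :=
          congrArg Word.parent (Word.right_append v w)
        rw [hl, hr]
      change (Word.parent (n := n + m) (g.1 (n + m + 1) (v.append w))).right =
        (g.1 (n + m) (v.append w.parent)).right
      rw [g.2 (n + m), h1]⟩

/-- The defining property `g (v w) = g(v) g|_v (w)` of the section. -/
theorem apply_append (g : TreeAut E) {n m : ℕ} (v : Word E n) (w : Word (shiftSeq E n) m) :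
    g.1 (n + m) (v.append w) = (g.1 n v).append ((sectionAt g v).1 m w) :=
  (append_sectionFun g v m w).symm

/-- `g` is finitary of depth at most `n`: all its sections at the `n`-th level are trivial. -/
def FinitaryOfDepthLE (g : TreeAut E) (n : ℕ) : Prop := ∀ v : Word E n, sectionAt g v = 1

/-- `g` is finitary. -/
def IsFinitary (g : TreeAut E) : Prop := ∃ n, FinitaryOfDepthLE g n

/-- The depth of a finitary automorphism (only meaningful for finitary `g`). -/
noncomputable def depth (g : TreeAut E) : ℕ := sInf {n | FinitaryOfDepthLE g n}

/-- `α_n(g)`: the number of vertices of level `n` at which `g` has a non-trivial section. -/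
noncomputable def alpha (g : TreeAut E) (n : ℕ) : ℕ :=
  Set.ncard {v : Word E n | sectionAt g v ≠ 1}

/-- `g` is bounded: the sequence `α_n(g)` is bounded. -/
def IsBounded (g : TreeAut E) : Prop := ∃ C : ℕ, ∀ n, alpha g n ≤ C

end TreeAut

/-! ### The boundary of the tree -/

/-- The set `X^ω` of infinite words. -/
def Boundary (E : ℕ → Type u) : Type u := (i : ℕ) → E i

namespace Boundary

variable {E : ℕ → Type u}

/-- The product topology, all alphabets being discrete. -/
instance : TopologicalSpace (Boundary E) := @Pi.topologicalSpace ℕ E (fun _ => ⊥)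

/-- The beginning of length `n` of an infinite word. -/
def pre (w : Boundary E) (n : ℕ) : Word E n := fun i => w i

/-- The action on infinite words: `act g w` is the word whose beginnings are the images under
`g` of the beginnings of `w`. -/
def act (g : TreeAut E) (w : Boundary E) : Boundary E :=
  fun i => g.1 (i + 1) (w.pre (i + 1)) (Fin.last i)

theorem pre_act (g : TreeAut E) (w : Boundary E) (n : ℕ) :
    (act g w).pre n = g.1 n (w.pre n) := by
  induction n with
  | zero => funext i; exact i.elim0
  | succ n ih =>
    funext i
    refine Fin.lastCases rfl (fun j => ?_) i
    have h : (g.1 (n + 1) (w.pre (n + 1))).parent = (act g w).pre n := by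
      rw [g.2 n, ih]; rfl
    exact (congrFun h j).symm

instance : MulAction (TreeAut E) (Boundary E) where
  smul := act
  one_smul := fun _ => rfl
  mul_smul := by
    intro g h w
    funext i
    change g.1 (i + 1) (h.1 (i + 1) (w.pre (i + 1))) (Fin.last i) =
      g.1 (i + 1) ((act h w).pre (i + 1)) (Fin.last i)
    rw [pre_act]

theorem pre_smul (g : TreeAut E) (w : Boundary E) (n : ℕ) :
    (g • w).pre n = g.1 n (w.pre n) := pre_act g w n

instance : ContinuousConstSMul (TreeAut E) (Boundary E) where
  continuous_const_smul := by
    intro g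
    let _ : ∀ i, TopologicalSpace (E i) := fun _ => ⊥
    have : ∀ i, DiscreteTopology (E i) := fun _ => ⟨rfl⟩
    refine continuous_pi (fun i => ?_)
    have h1 : Continuous (fun w : Boundary E => w.pre (i + 1)) :=
      continuous_pi (fun j => continuous_apply (A := E) (j : ℕ))
    have h2 : Continuous (fun v : Word E (i + 1) => g.1 (i + 1) v (Fin.last i)) :=
      continuous_of_discreteTopology
    exact h2.comp h1

instance (G : Subgroup (TreeAut E)) : ContinuousConstSMul G (Boundary E) where
  continuous_const_smul := fun g => continuous_const_smul (T := Boundary E) (g : TreeAut E)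

end Boundary

/-! ### Groups of germs -/

/-- The elements of the stabilizer of `x` that act trivially on a neighbourhood of `x`. -/
def trivialGerms (G : Type*) {X : Type*} [Group G] [TopologicalSpace X] [MulAction G X]
    (x : X) : Subgroup (MulAction.stabilizer G x) where
  carrier := {g | ∀ᶠ y in 𝓝 x, (g : G) • y = y}
  one_mem' := Filter.Eventually.of_forall fun y => one_smul G y
  mul_mem' := by
    intro a b ha hb
    filter_upwards [ha, hb] with y hya hyb
    change ((a : G) * (b : G)) • y = y
    rw [mul_smul, hyb, hya]
  inv_mem' := by
    intro a ha
    filter_upwards [ha] with y hy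
    change ((a : G)⁻¹) • y = y
    rw [inv_smul_eq_iff, hy]

instance trivialGerms_normal (G : Type*) {X : Type*} [Group G] [TopologicalSpace X]
    [MulAction G X] [ContinuousConstSMul G X] (x : X) : (trivialGerms G x).Normal where
  conj_mem := by
    intro a ha g
    have hg : ((g : G)⁻¹) • x = x := (g⁻¹).2
    have ht : Filter.Tendsto (fun y : X => ((g : G)⁻¹) • y) (𝓝 x) (𝓝 x) := by
      have := (continuous_const_smul (T := X) ((g : G)⁻¹)).tendsto x
      rwa [hg] at this
    filter_upwards [ht.eventually ha] with y hy
    change ((g : G) * (a : G) * (g : G)⁻¹) • y = y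
    rw [mul_smul, mul_smul, hy, smul_inv_smul]

/-- The group of germs (isotropy group of the groupoid of germs) at `x`. -/
abbrev GermGroup (G : Type*) {X : Type*} [Group G] [TopologicalSpace X]
    [MulAction G X] [ContinuousConstSMul G X] (x : X) : Type _ :=
  MulAction.stabilizer G x ⧸ trivialGerms G x

/-- A group is locally finite if its finitely generated subgroups are finite. -/
def IsLocallyFiniteGroup (Γ : Type*) [Group Γ] : Prop :=
  ∀ H : Subgroup Γ, H.FG → Finite H

/-! ### Amenability -/

/-- The action of `G` on the set `X` is amenable: there is an invariant finitely additive
probability measure on the family of all subsets of `X`. -/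
def IsAmenableAction (G X : Type*) [Group G] [MulAction G X] : Prop :=
  ∃ μ : Set X → ℝ, (∀ A, 0 ≤ μ A ∧ μ A ≤ 1) ∧
    (∀ A B, Disjoint A B → μ (A ∪ B) = μ A + μ B) ∧
    μ Set.univ = 1 ∧
    ∀ (g : G) (A : Set X), μ ((fun x => g • x) '' A) = μ A

/-- A (discrete) group is amenable if its action on itself by left multiplication is. -/
def IsAmenableGroup (G : Type*) [Group G] : Prop := IsAmenableAction G G

/-! ### Finitely supported functions with the `ℓ¹`-norm -/

/-! Amenability is proved through Reiter's condition, which concerns only finite sets of elements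
and therefore passes to directed unions of subgroups. Elements with boundedly many nontrivial
sections on each level form the group `boundedActivity`. Elements whose sections at vertices just
off any given ray are, far enough along it, finitary of depth at most n form the group `depthBound E
n`, increasing in n. Bounded activity forces these off-ray sections to be eventually finitary, so
every generator lies in some `depthBound E n` (`exists_hasDepthBound`), and it suffices to treat
groups Γ inside `boundedActivity E ⊓ depthBound E n`.

For g in Γ and an infinite word y, take the germ at infinity of the permutations that the sections
of g along y induce on words of length n + 1. Because the alphabets are bounded, these permutations
live in one finite group, so the germs form a locally finite group. This is a cocycle, and it
vanishes at (g, y) exactly when some section of g along y is trivial (`germVal_eq_one_iff`). Bounded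
activity gives it finite supports; elements of its kernel are finitary by compactness, so the kernel
is locally finite. On the stabilizer of w the cocycle is a homomorphism whose kernel acts trivially
near w, which gives the statement on germs.

For amenability, the action on the boundary is recurrent (`isRecurrentAction`), hence there are
almost invariant random finite sets containing any prescribed finite set
(`IsRecurrentAction.exists_isProb_finset`). Such a set, chosen to contain the relevant supports of
the cocycle, is decorated with a uniformly random function into a finite group of cocycle values.
The result is an almost invariant measure on a space whose relevant stabilizers are locally finite,
and it lifts to the group (`FinCocycle.isReiterAction`). -/

namespace Finsupp

variable {X Y : Type*}

/-- The `ℓ¹`-norm of a finitely supported function. -/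
noncomputable def l1 (f : X →₀ ℝ) : ℝ := f.sum fun _ c => |c|

theorem l1_eq_sum (f : X →₀ ℝ) {T : Finset X} (h : f.support ⊆ T) : l1 f = ∑ x ∈ T, |f x| :=
  Finsupp.sum_of_support_subset _ h _ (by simp)

theorem l1_nonneg (f : X →₀ ℝ) : 0 ≤ l1 f := Finset.sum_nonneg fun _ _ => abs_nonneg _

theorem l1_zero : l1 (0 : X →₀ ℝ) = 0 := by simp [l1]

theorem l1_add_le (f g : X →₀ ℝ) : l1 (f + g) ≤ l1 f + l1 g := by
  classical
  rw [l1_eq_sum f (T := f.support ∪ g.support) Finset.subset_union_left,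
    l1_eq_sum g (T := f.support ∪ g.support) Finset.subset_union_right,
    l1_eq_sum (f + g) Finsupp.support_add, ← Finset.sum_add_distrib]
  exact Finset.sum_le_sum fun x _ => abs_add_le _ _

theorem l1_smul (c : ℝ) (f : X →₀ ℝ) : l1 (c • f) = |c| * l1 f := by
  rw [l1_eq_sum (c • f) (T := f.support) Finsupp.support_smul,
    l1_eq_sum f Finset.Subset.rfl, Finset.mul_sum]
  exact Finset.sum_congr rfl fun x _ => by simp [abs_mul]

theorem l1_single (x : X) (c : ℝ) : l1 (single x c) = |c| := by simp [l1]

theorem l1_sum_le {ι : Type*} (s : Finset ι) (f : ι → X →₀ ℝ) :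
    l1 (∑ i ∈ s, f i) ≤ ∑ i ∈ s, l1 (f i) :=
  Finset.le_sum_of_subadditive _ l1_zero.le l1_add_le _ _

theorem l1_linearCombination_le (τ : X → Y →₀ ℝ) (hτ : ∀ x, l1 (τ x) ≤ 1) (f : X →₀ ℝ) :
    l1 (linearCombination ℝ τ f) ≤ l1 f := by
  rw [linearCombination_apply, Finsupp.sum]
  refine (l1_sum_le _ _).trans (Finset.sum_le_sum fun x _ => ?_)
  rw [l1_smul]
  exact mul_le_of_le_one_right (abs_nonneg _) (hτ x)

theorem l1_mapDomain_le (f : X → Y) (p : X →₀ ℝ) : l1 (mapDomain f p) ≤ l1 p := by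
  rw [mapDomain, Finsupp.sum]
  refine (l1_sum_le _ _).trans (Finset.sum_le_sum fun x _ => ?_)
  rw [l1_single]

/-- A finitely supported probability measure. -/
structure IsProb (p : X →₀ ℝ) : Prop where
  nonneg : ∀ x, 0 ≤ p x
  sum_eq : (p.sum fun _ c => c) = 1

theorem IsProb.l1_eq {p : X →₀ ℝ} (hp : IsProb p) : l1 p = 1 := by
  rw [← hp.sum_eq]
  exact Finset.sum_congr rfl fun x _ => abs_of_nonneg (hp.nonneg x)

/-- Here `τ` plays the role of a Markov kernel, and `linearCombination ℝ τ p` is the law of one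
random step from `p`. -/
theorem IsProb.linearCombination {p : X →₀ ℝ} (hp : IsProb p) {τ : X → Y →₀ ℝ}
    (hτ : ∀ x, IsProb (τ x)) : IsProb (linearCombination ℝ τ p) where
  nonneg y := by
    rw [linearCombination_apply, Finsupp.sum, Finsupp.finsetSum_apply]
    exact Finset.sum_nonneg fun x _ => mul_nonneg (hp.nonneg x) ((hτ x).nonneg y)
  sum_eq := by
    have h : ∀ f : Y →₀ ℝ, (f.sum fun _ c => c) = Finsupp.linearCombination ℝ (fun _ => (1 : ℝ)) f :=
      fun f => by simp [linearCombination_apply]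
    have hs : ∀ x, Finsupp.linearCombination ℝ (fun _ => (1 : ℝ)) (τ x) = 1 := fun x => by
      rw [← h, (hτ x).sum_eq]
    rw [h, linearCombination_apply _ (v := τ), map_finsuppSum]
    simp only [map_smul, hs, smul_eq_mul, mul_one]
    exact hp.sum_eq

theorem IsProb.mapDomain {p : X →₀ ℝ} (hp : IsProb p) (f : X → Y) : IsProb (mapDomain f p) := by
  have h : Finsupp.mapDomain f p = Finsupp.linearCombination ℝ (fun x => single (f x) (1 : ℝ)) p := by
    simp [linearCombination_apply, Finsupp.mapDomain]
  rw [h]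
  exact hp.linearCombination fun x =>
    ⟨fun y => by classical rw [single_apply]; split_ifs <;> norm_num, by simp⟩

/-- A Markov kernel that commutes with a map on the support of a probability measure does not
increase the distance of the measure from its image. -/
theorem l1_mapDomain_linearCombination_sub_le {p : X →₀ ℝ} {τ : X → Y →₀ ℝ}
    (hτ : ∀ x, IsProb (τ x)) (f : X → X) (f' : Y → Y)
    (h : ∀ x ∈ p.support, mapDomain f' (τ x) = τ (f x)) :
    l1 (mapDomain f' (linearCombination ℝ τ p) - linearCombination ℝ τ p) ≤
      l1 (mapDomain f p - p) := by
  have h1 : mapDomain f' (linearCombination ℝ τ p) = linearCombination ℝ τ (mapDomain f p) := by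
    rw [linearCombination_mapDomain, linearCombination_apply, linearCombination_apply,
      Finsupp.sum, Finsupp.sum, mapDomain_finsetSum]
    refine Finset.sum_congr rfl fun x hx => ?_
    rw [mapDomain_smul, h x hx, Function.comp]
  rw [h1, ← map_sub]
  exact l1_linearCombination_le τ (fun x => (hτ x).l1_eq.le) _

/-- The uniform probability measure on a finite set. -/
noncomputable def unif (A : Finset X) : X →₀ ℝ := ∑ a ∈ A, single a ((A.card : ℝ)⁻¹)

theorem isProb_unif {A : Finset X} (hA : A.Nonempty) : IsProb (unif A) where
  nonneg x := by
    classical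
    rw [unif, Finsupp.finsetSum_apply]
    refine Finset.sum_nonneg fun a _ => ?_
    rw [single_apply]
    split_ifs <;> positivity
  sum_eq := by
    rw [unif, ← Finsupp.sum_finsetSum_index (by simp) (by simp)]
    simp [hA.ne_empty]

theorem mapDomain_unif [DecidableEq Y] (A : Finset X) {f : X → Y} (hf : Set.InjOn f A) :
    mapDomain f (unif A) = unif (A.image f) := by
  rw [unif, unif, mapDomain_finsetSum, Finset.sum_image hf, Finset.card_image_of_injOn hf]
  simp

theorem mem_of_mem_support_unif {A : Finset X} {x : X} (hx : x ∈ (unif A).support) : x ∈ A := by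
  classical
  by_contra h
  refine (mem_support_iff.1 hx) ?_
  rw [unif, Finsupp.finsetSum_apply]
  exact Finset.sum_eq_zero fun a ha => single_eq_of_ne (by rintro rfl; exact h ha)

theorem exists_of_mem_support_linearCombination {p : X →₀ ℝ} {τ : X → Y →₀ ℝ} {y : Y}
    (hy : y ∈ (linearCombination ℝ τ p).support) :
    ∃ x ∈ p.support, y ∈ (τ x).support := by
  classical
  rw [linearCombination_apply] at hy
  obtain ⟨x, hx, hxy⟩ := Finset.mem_biUnion.1 (Finsupp.support_finsetSum hy)
  exact ⟨x, hx, Finsupp.support_smul hxy⟩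

/-- The total mass that a finitely supported function gives to a set. -/
noncomputable def massOn (A : Set X) : (X →₀ ℝ) →ₗ[ℝ] ℝ :=
  linearCombination ℝ (A.indicator fun _ => (1 : ℝ))

theorem massOn_apply (A : Set X) (f : X →₀ ℝ) :
    massOn A f = ∑ x ∈ f.support, f x * A.indicator (fun _ => (1 : ℝ)) x := by
  simp [massOn, linearCombination_apply, Finsupp.sum]

theorem abs_massOn_le (A : Set X) (f : X →₀ ℝ) : |massOn A f| ≤ l1 f := by
  rw [massOn_apply]
  refine (Finset.abs_sum_le_sum_abs _ _).trans (Finset.sum_le_sum fun x _ => ?_)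
  rw [abs_mul]
  refine mul_le_of_le_one_right (abs_nonneg _) ?_
  by_cases h : x ∈ A <;> simp [h]

theorem IsProb.massOn_nonneg {p : X →₀ ℝ} (hp : IsProb p) (A : Set X) : 0 ≤ massOn A p := by
  rw [massOn_apply]
  exact Finset.sum_nonneg fun x _ =>
    mul_nonneg (hp.nonneg x) (Set.indicator_nonneg (fun _ _ => zero_le_one) _)

theorem IsProb.massOn_le_one {p : X →₀ ℝ} (hp : IsProb p) (A : Set X) : massOn A p ≤ 1 :=
  (le_abs_self _).trans ((abs_massOn_le A p).trans hp.l1_eq.le)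

theorem IsProb.massOn_univ {p : X →₀ ℝ} (hp : IsProb p) : massOn Set.univ p = 1 := by
  rw [massOn_apply]
  simpa [Finsupp.sum] using hp.sum_eq

theorem massOn_union {A B : Set X} (h : Disjoint A B) (f : X →₀ ℝ) :
    massOn (A ∪ B) f = massOn A f + massOn B f := by
  simp only [massOn_apply, ← Finset.sum_add_distrib]
  refine Finset.sum_congr rfl fun x _ => ?_
  rw [Set.indicator_union_of_disjoint h, mul_add]

theorem massOn_image_mapDomain {f : X → Y} (hf : Function.Injective f) (A : Set X) (p : X →₀ ℝ) :
    massOn (f '' A) (mapDomain f p) = massOn A p := by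
  rw [massOn, massOn, linearCombination_mapDomain]
  congr 2
  funext x
  by_cases h : x ∈ A <;> simp [h, hf.mem_set_image, Set.indicator]

end Finsupp

open Finsupp

/-! ### Reiter's condition -/

/-- For every finite set of elements there are almost invariant finitely supported probability
measures. -/
def IsReiterAction (G X : Type*) [Group G] [MulAction G X] : Prop :=
  ∀ (S : Finset G) (ε : ℝ), 0 < ε → ∃ p : X →₀ ℝ, IsProb p ∧
    ∀ s ∈ S, l1 (mapDomain (fun x => s • x) p - p) ≤ ε

/-- The invariant mean is an ultralimit of almost invariant measures, indexed by a finite set of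
elements together with a precision. -/
theorem IsReiterAction.isAmenableAction {G X : Type*} [Group G] [MulAction G X]
    (h : IsReiterAction G X) : IsAmenableAction G X := by
  classical
  have h' : ∀ i : Finset G × ℕ, ∃ p : X →₀ ℝ, IsProb p ∧
      ∀ s ∈ i.1, l1 (mapDomain (fun x => s • x) p - p) ≤ 1 / ((i.2 : ℝ) + 1) :=
    fun i => h i.1 _ (by positivity)
  choose p hp hpS using h'
  let U : Ultrafilter (Finset G × ℕ) := Ultrafilter.of Filter.atTop
  have hU : (U : Filter (Finset G × ℕ)) ≤ Filter.atTop := Ultrafilter.of_le _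
  have hlim : ∀ A : Set X, ∃ c : ℝ, Filter.Tendsto (fun i => massOn A (p i)) U (𝓝 c) := by
    intro A
    obtain ⟨c, _, hc⟩ := (isCompact_Icc (a := (0 : ℝ)) (b := 1)).ultrafilter_le_nhds'
      (U.map fun i => massOn A (p i))
      (Filter.mem_map.2 (Filter.Eventually.of_forall fun i =>
        ⟨(hp i).massOn_nonneg A, (hp i).massOn_le_one A⟩))
    exact ⟨c, hc⟩
  choose μ hμ using hlim
  refine ⟨μ, fun A => ⟨?_, ?_⟩, fun A B hAB => ?_, ?_, fun g A => ?_⟩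
  · exact ge_of_tendsto' (hμ A) fun i => (hp i).massOn_nonneg A
  · exact le_of_tendsto' (hμ A) fun i => (hp i).massOn_le_one A
  · refine tendsto_nhds_unique (hμ _) ?_
    simp only [massOn_union hAB]
    exact (hμ A).add (hμ B)
  · refine tendsto_nhds_unique (hμ _) ?_
    simp only [(hp _).massOn_univ]
    exact tendsto_const_nhds
  · have h0 : Filter.Tendsto (fun i : Finset G × ℕ => 1 / ((i.2 : ℝ) + 1)) U (𝓝 0) :=
      ((tendsto_one_div_add_atTop_nhds_zero_nat (𝕜 := ℝ)).comp
        (Filter.tendsto_snd.mono_left Filter.prod_atTop_atTop_eq.ge)).mono_left hU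
    have hd : Filter.Tendsto (fun i => massOn ((fun x => g • x) '' A) (p i) - massOn A (p i)) U
        (𝓝 0) := by
      refine squeeze_zero_norm' (hU ?_) h0
      filter_upwards [Filter.eventually_ge_atTop (({g}, 0) : Finset G × ℕ)] with i hi
      have hg : g ∈ i.1 := hi.1 (Finset.mem_singleton_self g)
      refine le_trans ?_ (hpS i g hg)
      rw [← massOn_image_mapDomain (MulAction.injective g) A (p i), ← map_sub, Real.norm_eq_abs,
        ← abs_neg, ← map_neg, neg_sub]
      exact abs_massOn_le _ _
    have := tendsto_nhds_unique hd ((hμ _).sub (hμ A))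
    linarith

/-! ### Locally finite groups -/

theorem Subgroup.FG.map_hom {H K : Type*} [Group H] [Group K] {L : Subgroup H} (hL : L.FG)
    (f : H →* K) : (L.map f).FG := by
  obtain ⟨T, rfl, hT⟩ := (Subgroup.fg_iff L).1 hL
  exact (Subgroup.fg_iff _).2 ⟨f '' T, (MonoidHom.map_closure f T).symm, hT.image f⟩

theorem IsLocallyFiniteGroup.of_injective {H K : Type*} [Group H] [Group K]
    (hK : IsLocallyFiniteGroup K) (f : H →* K) (hf : Function.Injective f) :
    IsLocallyFiniteGroup H := fun L hL => by
  have := hK (L.map f) (hL.map_hom f)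
  exact Finite.of_equiv _ (L.equivMapOfInjective f hf).symm.toEquiv

theorem IsLocallyFiniteGroup.finite_closure {G : Type*} [Group G] {K : Subgroup G}
    (hK : IsLocallyFiniteGroup K) {T : Set G} (hT : T.Finite) (h : T ⊆ K) :
    Finite (Subgroup.closure T) := by
  have h1 : (Subgroup.closure (K.subtype ⁻¹' T)).map K.subtype = Subgroup.closure T := by
    rw [MonoidHom.map_closure, Set.image_preimage_eq_of_subset]
    simpa using h
  have h2 : Finite (Subgroup.closure (K.subtype ⁻¹' T)) :=
    hK _ ((Subgroup.fg_iff _).2 ⟨_, rfl, hT.preimage K.subtype_injective.injOn⟩)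
  rw [← h1]
  exact Finite.of_equiv _
    ((Subgroup.closure (K.subtype ⁻¹' T)).equivMapOfInjective _ K.subtype_injective).toEquiv

/-- By Schreier's lemma, `K` meets a finitely generated `H` in a finitely generated, hence finite,
subgroup of finite index in `H`. -/
theorem IsLocallyFiniteGroup.of_subgroup_finiteIndex {G : Type*} [Group G] (K : Subgroup G)
    [K.FiniteIndex] (hK : IsLocallyFiniteGroup K) : IsLocallyFiniteGroup G := fun H hH => by
  have : Group.FG H := (Group.fg_iff_subgroup_fg H).2 hH
  have h1 : Group.FG (K.subgroupOf H) := Subgroup.fg_of_index_ne_zero _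
  have h2 : (K.subgroupOf H).FG := (Group.fg_iff_subgroup_fg _).1 h1
  let f : K.subgroupOf H →* K := (H.subtype.comp (K.subgroupOf H).subtype).codRestrict K
    fun x => x.2
  have hf : Function.Injective f := fun x y hxy => Subtype.ext (Subtype.ext (congrArg (fun k : K => (k : G)) hxy))
  have h3 : Finite (⊤ : Subgroup (K.subgroupOf H)) :=
    hK.of_injective f hf ⊤ ((Group.fg_def).1 h1)
  have h4 : Finite (K.subgroupOf H) := Finite.of_equiv _ Subgroup.topEquiv.toEquiv
  exact (Subgroup.finite_iff_finite_and_finiteIndex (H := K.subgroupOf H)).2 ⟨h4, inferInstance⟩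

/-- An almost invariant measure on a `G`-set lifts to `G` if the stabilizers of the points of its
support are locally finite. -/
theorem exists_isProb_of_locallyFinite_stabilizer {G Z : Type*} [Group G] [MulAction G Z]
    {p : Z →₀ ℝ} (hp : IsProb p)
    (hst : ∀ z ∈ p.support, IsLocallyFiniteGroup (MulAction.stabilizer G z)) (S : Finset G) :
    ∃ q : G →₀ ℝ, IsProb q ∧ ∀ s ∈ S, l1 (mapDomain (fun x => s * x) q - q) ≤
      l1 (mapDomain (fun z => s • z) p - p) := by
  classical
  let rep : Z → Z := fun z => (Quotient.mk (MulAction.orbitRel G Z) z).out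
  have hrep : ∀ z, ∃ t : G, t • rep z = z := fun z =>
    (MulAction.orbitRel G Z).symm (Quotient.exact (Quotient.out_eq (Quotient.mk _ z)))
  have hrep_smul : ∀ (g : G) z, rep (g • z) = rep z := fun g z => by
    have : Quotient.mk (MulAction.orbitRel G Z) (g • z) = Quotient.mk _ z :=
      Quotient.sound ⟨g, rfl⟩
    simp only [rep, this]
  choose t ht using hrep
  -- Transport along the section `t` turns the moves z ↦ sz into finitely many elements of the
  -- stabilizer of the representative `r`, which therefore generate a finite group.
  let T : Z → Set G := fun r =>
    ⋃ z ∈ {z | z ∈ p.support ∧ rep z = r}, ⋃ s ∈ S, {(t (s • z))⁻¹ * s * t z}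
  have hTfin : ∀ r, (T r).Finite := fun r =>
    ((p.support.finite_toSet.subset fun z hz => hz.1)).biUnion fun z _ =>
      S.finite_toSet.biUnion fun s _ => Set.finite_singleton _
  have hLfin : ∀ r, Finite (Subgroup.closure (T r)) := by
    intro r
    by_cases hr : ∃ z ∈ p.support, rep z = r
    · obtain ⟨z, hz, rfl⟩ := hr
      have h1 : IsLocallyFiniteGroup (MulAction.stabilizer G (rep z)) :=
        (hst z hz).of_injective
          (MulAction.stabilizerEquivStabilizerOfOrbitRel
            (Quotient.exact (Quotient.out_eq (Quotient.mk _ z)))).toMonoidHom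
          (MulEquiv.injective _)
      refine h1.finite_closure (hTfin _) ?_
      intro g hg
      simp only [T, Set.mem_iUnion, Set.mem_singleton_iff] at hg
      obtain ⟨z', ⟨_, hz'⟩, s, _, rfl⟩ := hg
      change ((t (s • z'))⁻¹ * s * t z') • rep z = rep z
      rw [← hz', mul_smul, mul_smul, ht, inv_smul_eq_iff]
      conv_rhs => rw [← hrep_smul s z', ht]
    · have : T r = ∅ := by
        refine Set.eq_empty_of_forall_notMem fun g hg => ?_
        simp only [T, Set.mem_iUnion] at hg
        obtain ⟨z, ⟨hz, hz'⟩, _⟩ := hg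
        exact hr ⟨z, hz, hz'⟩
      rw [this, Subgroup.closure_empty]
      infer_instance
  let L : Z → Finset G := fun r => (Set.toFinite (Subgroup.closure (T r) : Set G)).toFinset
  have hL : ∀ r g, g ∈ L r ↔ g ∈ Subgroup.closure (T r) := fun r g => by simp [L]
  -- Uniform measure on the coset t(z)L. Since t(sz)⁻¹ s t(z) lies in L, left multiplication by s
  -- carries it to the coset attached to sz.
  let τ : Z → G →₀ ℝ := fun z => unif ((L (rep z)).image fun x => t z * x)
  have hτ : ∀ z, IsProb (τ z) := fun z => isProb_unif (Finset.Nonempty.image ⟨1, by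
    rw [hL]; exact one_mem _⟩ _)
  refine ⟨linearCombination ℝ τ p, hp.linearCombination hτ, fun s hs =>
    l1_mapDomain_linearCombination_sub_le hτ _ _ fun z hz => ?_⟩
  rw [mapDomain_unif _ (mul_right_injective s).injOn]
  simp only [τ]
  congr 1
  have hmem : (t (s • z))⁻¹ * s * t z ∈ Subgroup.closure (T (rep z)) := by
    refine Subgroup.subset_closure ?_
    simp only [T, Set.mem_iUnion]
    exact ⟨z, ⟨hz, rfl⟩, s, hs, rfl⟩
  rw [hrep_smul, Finset.image_image]
  ext g
  simp only [Finset.mem_image, Function.comp, hL]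
  constructor
  · rintro ⟨x, hx, rfl⟩
    exact ⟨_, mul_mem hmem hx, by group⟩
  · rintro ⟨x, hx, rfl⟩
    exact ⟨_, mul_mem (inv_mem hmem) hx, by group⟩

theorem IsLocallyFiniteGroup.isReiterAction {G : Type*} [Group G] (hG : IsLocallyFiniteGroup G) :
    IsReiterAction G G := by
  intro S ε hε
  let _ : MulAction G Unit :=
    { smul := fun _ x => x
      one_smul := fun _ => rfl
      mul_smul := fun _ _ _ => rfl }
  -- The Dirac mass of the one-point action is exactly invariant, and its stabilizer is the whole
  -- group.
  obtain ⟨q, hq, hqS⟩ := exists_isProb_of_locallyFinite_stabilizer (G := G) (Z := Unit)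
    (p := single () 1) ⟨fun _ => by simp, by simp⟩
    (fun z _ => hG.of_injective (Subgroup.subtype _) (Subgroup.subtype_injective _)) S
  refine ⟨q, hq, fun s hs => (hqS s hs).trans ?_⟩
  have : mapDomain (fun z : Unit => s • z) (single () (1 : ℝ)) = single () 1 := by simp
  rw [this, sub_self, l1_zero]
  exact hε.le

/-! ### Independent random subsets -/

section RandomSubset

variable {X : Type*}

open Classical in
/-- The square root of the probability that a random subset of `T`, containing each `x`
independently with probability `sin² θ_x`, is equal to `A`. -/
noncomputable def bernAmp (θ : X → ℝ) (T A : Finset X) : ℝ :=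
  (∏ x ∈ A, Real.sin (θ x)) * ∏ x ∈ T \ A, Real.cos (θ x)

/-- The law of a random subset of `T` that contains each `x` independently with probability
`sin² θ_x`. -/
noncomputable def bern (θ : X → ℝ) (T : Finset X) : Finset X →₀ ℝ :=
  ∑ A ∈ T.powerset, single A (bernAmp θ T A ^ 2)

/-- Amplitudes are unit vectors of ℓ² whose inner products factor over points: expanding the product
of cos θ cos θ' + sin θ sin θ' gives one term per subset. -/
theorem sum_bernAmp_mul (θ θ' : X → ℝ) (T : Finset X) :
    ∑ A ∈ T.powerset, bernAmp θ T A * bernAmp θ' T A = ∏ x ∈ T, Real.cos (θ x - θ' x) := by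
  classical
  simp only [Real.cos_sub, add_comm (Real.cos _ * _)]
  rw [Finset.prod_add]
  refine Finset.sum_congr rfl fun A _ => ?_
  rw [bernAmp, bernAmp, Finset.prod_mul_distrib, Finset.prod_mul_distrib]
  convert mul_mul_mul_comm _ _ _ _ using 3

theorem sum_bernAmp_sq (θ : X → ℝ) (T : Finset X) :
    ∑ A ∈ T.powerset, bernAmp θ T A ^ 2 = 1 := by
  simp only [sq, sum_bernAmp_mul, sub_self, Real.cos_zero, Finset.prod_const_one]

theorem isProb_bern (θ : X → ℝ) (T : Finset X) : IsProb (bern θ T) where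
  nonneg A := by
    classical
    rw [bern, Finsupp.finsetSum_apply]
    refine Finset.sum_nonneg fun B _ => ?_
    rw [single_apply]
    split_ifs <;> positivity
  sum_eq := by
    rw [bern, ← Finsupp.sum_finsetSum_index (by simp) (by simp)]
    simp [sum_bernAmp_sq]

theorem bernAmp_eq_zero {θ : X → ℝ} {T A : Finset X} {x : X} (hx : x ∈ T) (hA : x ∉ A)
    (hθ : Real.cos (θ x) = 0) : bernAmp θ T A = 0 := by
  classical
  rw [bernAmp, Finset.prod_eq_zero (i := x) (s := T \ A) (by simp [hx, hA]) hθ, mul_zero]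

theorem mem_of_mem_support_bern {θ : X → ℝ} {T A : Finset X} {x : X}
    (hA : A ∈ (bern θ T).support) (hx : x ∈ T) (hθ : Real.cos (θ x) = 0) : x ∈ A := by
  classical
  by_contra h
  refine (mem_support_iff.1 hA) ?_
  rw [bern, Finsupp.finsetSum_apply]
  refine Finset.sum_eq_zero fun B _ => ?_
  by_cases hBA : B = A
  · rw [hBA, bernAmp_eq_zero hx h hθ]
    simp
  · exact single_eq_of_ne (Ne.symm hBA)

/-- A point with angle 0 is almost surely not chosen. This allows two laws to be compared on a
common ground set. -/
theorem bern_eq_of_subset {θ : X → ℝ} {T U : Finset X} (hTU : T ⊆ U) (h : ∀ x ∉ T, θ x = 0) :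
    bern θ U = bern θ T := by
  classical
  refine (Finset.sum_congr rfl fun A hA => ?_).trans
    (Finset.sum_subset (f := fun A => single A (bernAmp θ U A ^ 2)) (Finset.powerset_mono.2 hTU)
      fun A _ hA => ?_) |>.symm
  · rw [bernAmp, bernAmp]
    congr 3
    refine (Finset.prod_subset (Finset.sdiff_subset_sdiff hTU subset_rfl) fun x hxU hxT => ?_)
    have : x ∉ T := fun hx => hxT (Finset.mem_sdiff.2 ⟨hx, (Finset.mem_sdiff.1 hxU).2⟩)
    rw [h x this, Real.cos_zero]
  · rw [Finset.mem_powerset, Finset.not_subset] at hA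
    obtain ⟨x, hxA, hxT⟩ := hA
    rw [bernAmp, Finset.prod_eq_zero hxA (by rw [h x hxT, Real.sin_zero])]
    simp

theorem mapDomain_bern (e : Equiv.Perm X) (θ : X → ℝ) (T : Finset X) :
    mapDomain (Finset.map e.toEmbedding) (bern θ T) =
      bern (fun x => θ (e.symm x)) (T.map e.toEmbedding) := by
  classical
  rw [bern, bern, mapDomain_finsetSum]
  refine Finset.sum_nbij' (Finset.map e.toEmbedding) (Finset.map e.symm.toEmbedding) ?_ ?_ ?_ ?_ ?_
  · intro A hA
    simpa using hA
  · intro A hA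
    rw [Finset.mem_powerset] at hA ⊢
    intro x hx
    obtain ⟨y, hy, rfl⟩ := Finset.mem_map.1 hx
    obtain ⟨z, hz, rfl⟩ := Finset.mem_map.1 (hA hy)
    simpa using hz
  · intro A _
    ext x
    simp
  · intro A _
    ext x
    simp
  · intro A _
    rw [mapDomain_single, bernAmp, bernAmp, ← Finset.map_sdiff, Finset.prod_map, Finset.prod_map]
    simp

theorem one_sub_sum_le_prod {ι : Type*} (T : Finset ι) (c t : ι → ℝ) (ht : ∀ i ∈ T, 0 ≤ t i)
    (ht1 : ∀ i ∈ T, t i ≤ 1) (hc : ∀ i ∈ T, 1 - t i ≤ c i) (hc1 : ∀ i ∈ T, c i ≤ 1) :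
    1 - ∑ i ∈ T, t i ≤ ∏ i ∈ T, c i := by
  classical
  induction T using Finset.induction_on with
  | empty => simp
  | insert a T ha ih =>
    simp only [Finset.mem_insert, forall_eq_or_imp] at ht ht1 hc hc1
    have h1 := ih ht.2 ht1.2 hc.2 hc1.2
    rw [Finset.sum_insert ha, Finset.prod_insert ha]
    have h2 : 0 ≤ ∏ i ∈ T, c i := Finset.prod_nonneg fun i hi => by
      linarith [ht1.2 i hi, hc.2 i hi]
    have h3 : ∏ i ∈ T, c i ≤ 1 := Finset.prod_le_one
      (fun i hi => by linarith [ht1.2 i hi, hc.2 i hi]) hc1.2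
    nlinarith [hc.1, ht.1]

/-- Two such laws with close parameters are close. -/
theorem l1_bern_sub_sq_le (θ θ' : X → ℝ) (T : Finset X) (h : ∑ x ∈ T, (θ x - θ' x) ^ 2 ≤ 1) :
    l1 (bern θ T - bern θ' T) ^ 2 ≤ 4 * ∑ x ∈ T, (θ x - θ' x) ^ 2 := by
  have h1 : l1 (bern θ T - bern θ' T) ≤
      ∑ A ∈ T.powerset, |bernAmp θ T A - bernAmp θ' T A| * |bernAmp θ T A + bernAmp θ' T A| := by
    rw [bern, bern, ← Finset.sum_sub_distrib]
    refine (l1_sum_le _ _).trans (Finset.sum_le_sum fun A _ => ?_)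
    rw [← single_sub, l1_single, ← abs_mul]
    exact (congrArg abs (by ring)).le
  -- Cauchy–Schwarz for a² - b² = (a - b)(a + b): with ρ the overlap of the amplitudes, the two
  -- factors are 2 - 2ρ and 2 + 2ρ, and ρ is at least one minus half the sum of squared differences.
  have h2 := Finset.sum_mul_sq_le_sq_mul_sq T.powerset
    (fun A => |bernAmp θ T A - bernAmp θ' T A|) fun A => |bernAmp θ T A + bernAmp θ' T A|
  simp only [sq_abs, sub_sq, add_sq, Finset.sum_add_distrib, Finset.sum_sub_distrib,
    sum_bernAmp_sq, mul_assoc, ← Finset.mul_sum, sum_bernAmp_mul] at h2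
  have h3 : 1 - ∑ x ∈ T, (θ x - θ' x) ^ 2 / 2 ≤ ∏ x ∈ T, Real.cos (θ x - θ' x) := by
    refine one_sub_sum_le_prod T _ _ (fun x _ => by positivity) (fun x hx => ?_)
      (fun x _ => Real.one_sub_sq_div_two_le_cos) fun x _ => Real.cos_le_one _
    have := Finset.single_le_sum (f := fun x => (θ x - θ' x) ^ 2) (fun x _ => sq_nonneg _) hx
    linarith
  rw [← Finset.sum_div] at h3
  have h4 : ∏ x ∈ T, Real.cos (θ x - θ' x) ≤ 1 := by
    refine (le_abs_self _).trans ?_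
    rw [Finset.abs_prod]
    exact Finset.prod_le_one (fun _ _ => abs_nonneg _) fun _ _ => Real.abs_cos_le_one _
  have h5 := pow_le_pow_left₀ (l1_nonneg _) h1 2
  nlinarith

end RandomSubset

/-! ### Recurrent actions -/

/-- Every finite set has capacity zero: there are finitely supported functions that are equal to
one on it and have small Dirichlet energy. -/
def IsRecurrentAction (G X : Type*) [Group G] [MulAction G X] : Prop :=
  ∀ (S : Finset G) (F : Finset X) (ε : ℝ), 0 < ε → ∃ a : X → ℝ,
    (∃ D : Finset X, ∀ x ∉ D, a x = 0) ∧ (∀ x ∈ F, a x = 1) ∧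
    ∀ s ∈ S, ∀ T : Finset X, ∑ x ∈ T, (a (s • x) - a x) ^ 2 ≤ ε

/-- A recurrent action is extensively amenable. -/
theorem IsRecurrentAction.exists_isProb_finset {G X : Type*} [Group G] [MulAction G X]
    (h : IsRecurrentAction G X) (S : Finset G) (F : Finset X) {ε : ℝ} (hε : 0 < ε) :
    ∃ p : Finset X →₀ ℝ, IsProb p ∧ (∀ A ∈ p.support, F ⊆ A) ∧
      ∀ s ∈ S, l1 (mapDomain (Finset.map (MulAction.toPerm s).toEmbedding) p - p) ≤ ε := by
  classical
  -- Rescaling `a` by π/2 makes the points of `F` certain to be chosen. The energy of the angles is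
  -- then at most 1, as `l1_bern_sub_sq_le` requires, and at most ε²/4, which gives distance at most
  -- ε.
  obtain ⟨a, ⟨D, hD⟩, hF, hS⟩ := h S F (min 1 (ε ^ 2 / 4) / (Real.pi / 2) ^ 2) (by positivity)
  let θ : X → ℝ := fun x => Real.pi / 2 * a x
  have hθD : ∀ x ∉ D, θ x = 0 := fun x hx => by simp [θ, hD x hx]
  refine ⟨bern θ D, isProb_bern _ _, fun A hA x hx => ?_, fun s hs => ?_⟩
  · refine mem_of_mem_support_bern hA ?_ (by simp [θ, hF x hx])
    by_contra hxD
    simpa [hF x hx] using hD x hxD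
  · set e : Equiv.Perm X := MulAction.toPerm s with he
    set U := D ∪ D.map e.toEmbedding with hU
    rw [mapDomain_bern, ← bern_eq_of_subset (θ := θ) (Finset.subset_union_left : D ⊆ U) hθD,
      ← bern_eq_of_subset (Finset.subset_union_right : D.map e.toEmbedding ⊆ U)]
    · have hE : ∑ x ∈ U, (θ (e.symm x) - θ x) ^ 2 ≤ min 1 (ε ^ 2 / 4) := by
        have h1 := hS s hs (U.map e.symm.toEmbedding)
        rw [Finset.sum_map, le_div_iff₀ (by positivity), Finset.sum_mul] at h1
        refine le_trans (Finset.sum_le_sum fun x _ => ?_) h1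
        have h2 : s • e.symm x = x := e.apply_symm_apply x
        simp only [Equiv.coe_toEmbedding, h2, θ]
        exact (by ring : _ = _).le
      have h1 := l1_bern_sub_sq_le (fun x => θ (e.symm x)) θ U (hE.trans (min_le_left _ _))
      have h2 := hE.trans (min_le_right _ _)
      refine le_of_sq_le_sq ?_ hε.le
      linarith
    · intro x hx
      refine hθD _ fun h => hx (Finset.mem_map.2 ⟨_, h, e.apply_symm_apply x⟩)

/-- A criterion for recurrence: an exhaustion of an invariant set by finite sets with boundaries
of bounded size. -/
theorem exists_smallEnergy_of_bounded_boundary {G X : Type*} [Group G] [MulAction G X]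
    (S : Finset G) (hS : ∀ s ∈ S, s⁻¹ ∈ S) (F : ℕ → Finset X) (hF : Monotone F)
    (hex : ∀ s ∈ S, ∀ k, ∃ l, ∀ x ∈ F k, s • x ∈ F l)
    (hbd : ∀ s ∈ S, ∃ C : ℕ, ∀ k, {x | x ∈ F k ∧ s • x ∉ F k}.ncard ≤ C) {ε : ℝ} (hε : 0 < ε) :
    ∃ a : X → ℝ, (∃ D : Finset X, ∀ x ∉ D, a x = 0) ∧ (∀ x ∈ F 0, a x = 1) ∧
      ∀ s ∈ S, ∀ T : Finset X, ∑ x ∈ T, (a (s • x) - a x) ^ 2 ≤ ε := by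
  classical
  choose! C hC using hbd
  choose! l hl using hex
  -- Bounds the exits under s plus the entries under s, the latter being exits under s⁻¹.
  let C' : ℕ := 2 * ∑ s ∈ S, C s
  let next : ℕ → ℕ := fun k => k + ∑ s ∈ S, l s k
  -- A sparse subsequence in which `S` moves each set into the next one, so that the edge boundaries
  -- of different sets are disjoint.
  let K : ℕ → Finset X := fun j => F (next^[j] 0)
  have hlnext : ∀ s ∈ S, ∀ k, l s k ≤ next k := fun s hs k =>
    (Finset.single_le_sum (f := fun s => l s k) (fun _ _ => Nat.zero_le _) hs).trans
      (Nat.le_add_left _ _)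
  have hKsucc : ∀ j, ∀ s ∈ S, ∀ x ∈ K j, s • x ∈ K (j + 1) := fun j s hs x hx => by
    simp only [K, Function.iterate_succ_apply']
    exact hF (hlnext s hs _) (hl s hs _ x hx)
  have hK : Monotone K := by
    refine monotone_nat_of_le_succ fun j => ?_
    simp only [K, Function.iterate_succ_apply']
    exact hF (Nat.le_add_right _ _)
  obtain ⟨N, hN⟩ := exists_nat_gt (max 1 ((C' : ℝ) / ε))
  have hN1 : (1 : ℝ) < N := (le_max_left _ _).trans_lt hN
  have hN0 : (0 : ℝ) < N := by linarith
  let χ : ℕ → X → ℝ := fun j x => if x ∈ K j then 1 else 0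
  let Dl : G → ℕ → Set X := fun s j => {x | x ∈ K j ∧ s • x ∉ K j} ∪ {x | x ∉ K j ∧ s • x ∈ K j}
  have hDl : ∀ s j x, x ∉ Dl s j → χ j (s • x) = χ j x := fun s j x hx => by
    simp only [Dl, Set.mem_union, Set.mem_ofPred_eq, not_or, not_and, not_not] at hx
    simp only [χ]
    by_cases h : x ∈ K j
    · rw [if_pos h, if_pos (hx.1 h)]
    · rw [if_neg h, if_neg (hx.2 h)]
  have hDfin : ∀ s j, (Dl s j).Finite := fun s j =>
    ((K j).finite_toSet.subset fun x hx => hx.1).union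
      (((K j).finite_toSet.preimage (MulAction.injective s).injOn).subset fun x hx => hx.2)
  have hDcard : ∀ s ∈ S, ∀ j, (Dl s j).ncard ≤ C' := fun s hs j => by
    refine (Set.ncard_union_le _ _).trans ?_
    have h1 : {x | x ∉ K j ∧ s • x ∈ K j}.ncard ≤ C s⁻¹ := by
      rw [← Set.ncard_image_of_injective _ (MulAction.injective s)]
      refine le_trans (Set.ncard_le_ncard ?_ ?_) (hC s⁻¹ (hS s hs) (next^[j] 0))
      · rintro _ ⟨x, hx, rfl⟩
        refine ⟨hx.2, ?_⟩
        simpa using hx.1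
      · exact (K j).finite_toSet.subset fun x hx => hx.1
    have h2 := hC s hs (next^[j] 0)
    have h3 := Finset.single_le_sum (f := C) (fun _ _ => Nat.zero_le _) hs
    have h4 := Finset.single_le_sum (f := C) (fun _ _ => Nat.zero_le _) (hS s hs)
    simp only [C']
    change {x | x ∈ K j ∧ s • x ∉ K j}.ncard ≤ C s at h2
    omega
  have hdisj : ∀ s ∈ S, ∀ x i j, i < j → x ∈ Dl s i → x ∉ Dl s j := by
    intro s hs x i j hij hx
    have hxs : x ∈ K (i + 1) ∧ s • x ∈ K (i + 1) := by
      rcases hx with hx | hx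
      · exact ⟨hK (Nat.le_succ i) hx.1, hKsucc i s hs x hx.1⟩
      · refine ⟨?_, hK (Nat.le_succ i) hx.2⟩
        simpa using hKsucc i s⁻¹ (hS s hs) _ hx.2
    have h1 := hK (Nat.succ_le_of_lt hij) hxs.1
    have h2 := hK (Nat.succ_le_of_lt hij) hxs.2
    rintro (h | h)
    · exact h.2 h2
    · exact h.1 h1
  -- Each edge is cut by at most one of the N indicators and then contributes 1/N², so the energy is
  -- at most N · C'/N² = C'/N.
  let a : X → ℝ := fun x => (∑ j ∈ Finset.range N, χ j x) / N
  refine ⟨a, ⟨K N, fun x hx => ?_⟩, fun x hx => ?_, fun s hs T => ?_⟩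
  · have : ∀ j ∈ Finset.range N, χ j x = 0 := fun j hj =>
      if_neg fun h => hx (hK (Finset.mem_range.1 hj).le h)
    simp [a, Finset.sum_eq_zero this]
  · have : ∀ j ∈ Finset.range N, χ j x = 1 := fun j _ => if_pos (hK (Nat.zero_le j) hx)
    simp only [a, Finset.sum_congr rfl this]
    simp [hN0.ne']
  · have hterm : ∀ x, (a (s • x) - a x) ^ 2 ≤
        ∑ j ∈ Finset.range N, if x ∈ Dl s j then 1 / (N : ℝ) ^ 2 else 0 := by
      intro x
      have hax : a (s • x) - a x = (∑ j ∈ Finset.range N, (χ j (s • x) - χ j x)) / N := by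
        simp only [a, Finset.sum_sub_distrib, sub_div]
      by_cases hx : ∃ j ∈ Finset.range N, x ∈ Dl s j
      · obtain ⟨j, hj, hxj⟩ := hx
        have hne : ∀ i, i ≠ j → x ∉ Dl s i := fun i hi hxi => by
          rcases lt_or_gt_of_ne hi with h | h
          · exact hdisj s hs x i j h hxi hxj
          · exact hdisj s hs x j i h hxj hxi
        rw [hax, Finset.sum_eq_single_of_mem j hj fun i _ hi => by
          rw [hDl s i x (hne i hi), sub_self],
          Finset.sum_eq_single_of_mem j hj fun i _ hi => if_neg (hne i hi), if_pos hxj, div_pow]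
        gcongr
        simp only [χ]
        split_ifs <;> norm_num
      · push Not at hx
        rw [hax, Finset.sum_eq_zero fun j hj => by rw [hDl s j x (hx j hj), sub_self]]
        simp only [zero_div, ne_eq, OfNat.ofNat_ne_zero, not_false_eq_true, zero_pow]
        exact Finset.sum_nonneg fun j _ => by split_ifs <;> positivity
    refine (Finset.sum_le_sum fun x _ => hterm x).trans ?_
    rw [Finset.sum_comm]
    have hj : ∀ j ∈ Finset.range N, (∑ x ∈ T, if x ∈ Dl s j then 1 / (N : ℝ) ^ 2 else 0) ≤
        C' / (N : ℝ) ^ 2 := by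
      intro j _
      rw [← Finset.sum_filter, Finset.sum_const, nsmul_eq_mul, mul_one_div]
      gcongr
      refine le_trans ?_ (hDcard s hs j)
      rw [← Set.ncard_coe_finset]
      exact Set.ncard_le_ncard (fun x hx => (Finset.mem_filter.1 hx).2) (hDfin s j)
    refine (Finset.sum_le_sum hj).trans ?_
    have h1 : (C' : ℝ) / ε < N := (le_max_right _ _).trans_lt hN
    rw [div_lt_iff₀ hε] at h1
    rw [Finset.sum_const, Finset.card_range, nsmul_eq_mul, mul_div_assoc', div_le_iff₀ (by positivity)]
    nlinarith

/-! ### Cocycles with finite supports -/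

/-- A cocycle of an action of `G` on `X` with values in `P` whose restriction to every element
of `G` has finite support. -/
structure FinCocycle (G X P : Type*) [Group G] [MulAction G X] [Group P] where
  /-- The value of the cocycle. -/
  val : G → X → P
  val_mul : ∀ g h x, val (g * h) x = val g (h • x) * val h x
  finite_support : ∀ g, {x | val g x ≠ 1}.Finite

namespace FinCocycle

variable {G X P : Type*} [Group G] [MulAction G X] [Group P] (c : FinCocycle G X P)

theorem val_one (x : X) : c.val 1 x = 1 := by
  have h := c.val_mul 1 1 x
  rwa [one_smul, mul_one, eq_comm, mul_eq_left] at h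

theorem val_inv_smul (g : G) (x : X) : c.val g⁻¹ (g • x) = (c.val g x)⁻¹ := by
  rw [eq_inv_iff_mul_eq_one, ← c.val_mul, inv_mul_cancel, val_one]

/-- The elements on which the cocycle is trivial. -/
def ker : Subgroup G where
  carrier := {g | ∀ x, c.val g x = 1}
  one_mem' := c.val_one
  mul_mem' := fun {a b} ha hb x => by rw [c.val_mul, ha, hb, one_mul]
  inv_mem' := fun {a} ha x => by
    have := c.val_inv_smul a (a⁻¹ • x)
    rwa [smul_inv_smul, ha, inv_one] at this

/-- The space of pairs of a finite subset of `X` and a function on `X` with values in `P`, on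
which `G` acts by the cocycle. -/
@[ext]
structure Config (_ : FinCocycle G X P) where
  /-- The finite set. -/
  fst : Finset X
  /-- The function. -/
  snd : X → P

instance : MulAction G c.Config where
  smul g z :=
    ⟨z.1.map (MulAction.toPerm g).toEmbedding, fun y => c.val g (g⁻¹ • y) * z.2 (g⁻¹ • y)⟩
  one_smul z := by
    refine Config.ext ?_ ?_
    · change z.1.map (MulAction.toPerm (1 : G)).toEmbedding = z.1
      ext x
      simp
    · funext y
      change c.val 1 _ * z.2 ((1 : G)⁻¹ • y) = z.2 y
      rw [val_one, inv_one, one_smul, one_mul]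
  mul_smul g h z := by
    refine Config.ext ?_ ?_
    · change z.1.map (MulAction.toPerm (g * h)).toEmbedding =
        (z.1.map (MulAction.toPerm h).toEmbedding).map (MulAction.toPerm g).toEmbedding
      rw [Finset.map_map]
      congr 1
      ext x
      simp [mul_smul]
    · funext y
      change c.val (g * h) ((g * h)⁻¹ • y) * z.2 ((g * h)⁻¹ • y) =
        c.val g (g⁻¹ • y) * (c.val h (h⁻¹ • g⁻¹ • y) * z.2 (h⁻¹ • g⁻¹ • y))
      rw [c.val_mul, mul_inv_rev, mul_smul, smul_inv_smul, mul_assoc]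

theorem smul_fst (g : G) (z : c.Config) :
    (g • z).1 = z.1.map (MulAction.toPerm g).toEmbedding := rfl

theorem smul_snd (g : G) (z : c.Config) (y : X) :
    (g • z).2 (g • y) = c.val g y * z.2 y := by
  change c.val g (g⁻¹ • g • y) * z.2 (g⁻¹ • g • y) = _
  rw [inv_smul_smul]

/-- The functions with values in `Λ` supported on `A`. -/
def configsOn (Λ : Subgroup P) (A : Finset X) : Set c.Config :=
  {z | z.1 = A ∧ (∀ x, z.2 x ∈ Λ) ∧ ∀ x ∉ A, z.2 x = 1}

theorem finite_configsOn (Λ : Subgroup P) [Finite Λ] (A : Finset X) :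
    (c.configsOn Λ A).Finite := by
  classical
  let f : (A → Λ) → c.Config := fun Φ => ⟨A, fun x => if h : x ∈ A then (Φ ⟨x, h⟩ : P) else 1⟩
  refine (Set.finite_range f).subset fun z hz => ⟨fun x => ⟨z.2 x, hz.2.1 x⟩, ?_⟩
  refine Config.ext hz.1.symm (funext fun x => ?_)
  by_cases h : x ∈ A
  · simp [f, h]
  · simp [f, h, hz.2.2 x h]

theorem smul_mem_configsOn {Λ : Subgroup P} {A : Finset X} {g : G} (hΛ : ∀ x, c.val g x ∈ Λ)
    (hA : ∀ x ∉ A, c.val g x = 1) {z : c.Config} (hz : z ∈ c.configsOn Λ A) :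
    g • z ∈ c.configsOn Λ (A.map (MulAction.toPerm g).toEmbedding) := by
  refine ⟨by rw [smul_fst, hz.1], fun x => ?_, fun x hx => ?_⟩
  · obtain ⟨y, rfl⟩ := MulAction.surjective g x
    rw [smul_snd]
    exact mul_mem (hΛ _) (hz.2.1 _)
  · obtain ⟨y, rfl⟩ := MulAction.surjective g x
    have hy : y ∉ A := fun h => hx (Finset.mem_map.2 ⟨y, h, rfl⟩)
    rw [smul_snd, hA y hy, hz.2.2 y hy, one_mul]

theorem image_smul_configsOn {Λ : Subgroup P} {A : Finset X} {g : G} (hΛ : ∀ x, c.val g x ∈ Λ)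
    (hA : ∀ x ∉ A, c.val g x = 1) :
    (fun z : c.Config => g • z) '' c.configsOn Λ A =
      c.configsOn Λ (A.map (MulAction.toPerm g).toEmbedding) := by
  refine Set.Subset.antisymm ?_ fun z hz => ⟨g⁻¹ • z, ?_, smul_inv_smul g z⟩
  · rintro _ ⟨z, hz, rfl⟩
    exact c.smul_mem_configsOn hΛ hA hz
  · have h := c.smul_mem_configsOn (g := g⁻¹) (fun x => ?_) (fun x hx => ?_) hz
    · convert h
      ext x
      simp
    · obtain ⟨y, rfl⟩ := MulAction.surjective g x
      rw [val_inv_smul]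
      exact inv_mem (hΛ y)
    · obtain ⟨y, rfl⟩ := MulAction.surjective g x
      rw [val_inv_smul, hA y fun h => hx (Finset.mem_map.2 ⟨y, h, rfl⟩), inv_one]

/-- The stabilizer permutes the finite set of `z`, so a finite-index subgroup fixes it pointwise. An
element of that subgroup preserves the values of `z.2`, on the set and off it, so invariance of `z`
forces its cocycle to be trivial. -/
theorem isLocallyFiniteGroup_stabilizer (hker : IsLocallyFiniteGroup c.ker) {z : c.Config}
    (hz : ∀ x ∉ z.1, z.2 x = 1) : IsLocallyFiniteGroup (MulAction.stabilizer G z) := by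
  have horb : ∀ x ∈ z.1, MulAction.orbit (MulAction.stabilizer G z) x ⊆ z.1 := by
    rintro x hx _ ⟨g, rfl⟩
    have h : (g : G) • z = z := g.2
    have hgx : (g : G) • x ∈ ((g : G) • z).1 := Finset.mem_map.2 ⟨x, hx, rfl⟩
    rwa [h] at hgx
  have hfin : ∀ x : z.1, (MulAction.stabilizer (MulAction.stabilizer G z) (x : X)).FiniteIndex :=
    fun x => ⟨by
      rw [MulAction.index_stabilizer]
      exact (Set.ncard_pos (z.1.finite_toSet.subset (horb x x.2))).2
        (MulAction.nonempty_orbit (x : X)) |>.ne'⟩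
  have hK := Subgroup.finiteIndex_iInf (f := fun x : z.1 =>
    MulAction.stabilizer (MulAction.stabilizer G z) (x : X)) hfin
  refine IsLocallyFiniteGroup.of_subgroup_finiteIndex (⨅ x : z.1,
    MulAction.stabilizer (MulAction.stabilizer G z) (x : X)) ?_
  refine hker.of_injective (((MulAction.stabilizer G z).subtype.comp
    (Subgroup.subtype _)).codRestrict c.ker fun g y => ?_) fun g h hgh => ?_
  · have hg : ((g : MulAction.stabilizer G z) : G) • z = z := (g : MulAction.stabilizer G z).2
    have h1 := c.smul_snd ((g : MulAction.stabilizer G z) : G) z y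
    have hfix : ∀ x ∈ z.1, ((g : MulAction.stabilizer G z) : G) • x = x := fun x hx => by
      have := Subgroup.mem_iInf.1 g.2 ⟨x, hx⟩
      exact this
    rw [hg] at h1
    have h2 : z.2 (((g : MulAction.stabilizer G z) : G) • y) = z.2 y := by
      by_cases hy : y ∈ z.1
      · rw [hfix y hy]
      · rw [hz y hy, hz]
        intro h
        have := hfix _ h
        rw [smul_left_cancel_iff] at this
        exact hy (this ▸ h)
    rw [h2] at h1
    exact mul_eq_right.1 h1.symm
  · exact Subtype.ext (Subtype.ext (congrArg (fun k : c.ker => (k : G)) hgh))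

/-- A group with a recurrent action and a finitely supported cocycle of this action with values
in a locally finite group satisfies Reiter's condition if the kernel of the cocycle is locally
finite. -/
theorem isReiterAction (hP : IsLocallyFiniteGroup P) (hrec : IsRecurrentAction G X)
    (hker : IsLocallyFiniteGroup c.ker) : IsReiterAction G G := by
  classical
  intro S ε hε
  let V : Set P := insert 1 (⋃ s ∈ S, c.val s '' {x | c.val s x ≠ 1})
  have hV : V.Finite :=
    (S.finite_toSet.biUnion fun s _ => (c.finite_support s).image _).insert _
  let Λ : Subgroup P := Subgroup.closure V
  have hΛ : Finite Λ := hP _ ((Subgroup.fg_iff _).2 ⟨V, rfl, hV⟩)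
  have hΛS : ∀ s ∈ S, ∀ x, c.val s x ∈ Λ := fun s hs x => by
    by_cases h : c.val s x = 1
    · rw [h]
      exact one_mem _
    · exact Subgroup.subset_closure
        (Or.inr (Set.mem_biUnion (Finset.mem_coe.2 hs) ⟨x, h, rfl⟩))
  -- If a finite set contains all these supports, elements of `S` multiply decorations only at its
  -- points, so they carry its decorations onto those of the translated set.
  let F : Finset X := S.biUnion fun s => (c.finite_support s).toFinset
  obtain ⟨p, hp, hpF, hpS⟩ := hrec.exists_isProb_finset S F hε
  let τ : Finset X → c.Config →₀ ℝ := fun A => unif (c.finite_configsOn Λ A).toFinset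
  have hτ : ∀ A, IsProb (τ A) := fun A =>
    isProb_unif ⟨⟨A, fun _ => 1⟩, by simp [configsOn, one_mem Λ]⟩
  obtain ⟨q, hq, hqS⟩ := exists_isProb_of_locallyFinite_stabilizer (hp.linearCombination hτ)
    (fun z hz => by
      obtain ⟨A, _, hA⟩ := exists_of_mem_support_linearCombination hz
      have := mem_of_mem_support_unif hA
      rw [Set.Finite.mem_toFinset] at this
      obtain ⟨rfl, _, h⟩ := this
      exact c.isLocallyFiniteGroup_stabilizer hker h) S
  refine ⟨q, hq, fun s hs => (hqS s hs).trans (le_trans ?_ (hpS s hs))⟩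
  refine l1_mapDomain_linearCombination_sub_le hτ _ _ fun A hA => ?_
  rw [mapDomain_unif _ (MulAction.injective s).injOn]
  simp only [τ]
  congr 1
  rw [← Finset.coe_inj, Finset.coe_image, Set.Finite.coe_toFinset, Set.Finite.coe_toFinset]
  refine c.image_smul_configsOn (hΛS s hs) fun x hx => ?_
  by_contra h
  exact hx (hpF A hA (Finset.mem_biUnion.2 ⟨s, hs, by simpa using h⟩))

end FinCocycle

/-! ### Groups of eventual sequences in a finite group -/

theorem isLocallyFiniteGroup_germ {ι : Type*} (l : Filter ι) (F : Type*) [Group F] [Finite F] :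
    IsLocallyFiniteGroup (l.Germ F) := by
  intro H hH
  obtain ⟨T, rfl, hT⟩ := (Subgroup.fg_iff H).1 hH
  have := hT.to_subtype
  have hr : ∀ t : T, ∃ r : ι → F, (r : l.Germ F) = t := fun t => Quotient.exists_rep t.1
  choose r hr using hr
  -- Representatives of the generators form one sequence of tuples in the finite set `T → F`;
  -- functions of the tuple form a finite group whose image contains every generator.
  let ψ : ((T → F) → F) →* l.Germ F :=
    (Filter.Germ.coeMulHom l).comp
      { toFun := fun u k => u fun t => r t k
        map_one' := rfl
        map_mul' := fun _ _ => rfl }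
  have hle : Subgroup.closure T ≤ ψ.range := (Subgroup.closure_le _).2 fun t ht =>
    ⟨fun a => a ⟨t, ht⟩, hr ⟨t, ht⟩⟩
  exact Finite.Set.subset (Set.range ψ) hle

theorem IsLocallyFiniteGroup.of_ker_le {K Q P : Type*} [Group K] [Group Q] [Group P]
    (hP : IsLocallyFiniteGroup P) (f : K →* Q) (φ : K →* P) (h : φ.ker ≤ f.ker) {T : Set K}
    (hT : T.Finite) : Finite ((Subgroup.closure T).map f) := by
  have h1 : Finite ((Subgroup.closure T).map φ) :=
    hP _ (((Subgroup.fg_iff _).2 ⟨T, rfl, hT⟩ : (Subgroup.closure T).FG).map_hom φ)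
  have hr : ∀ p : (Subgroup.closure T).map φ, ∃ k ∈ Subgroup.closure T, φ k = p := fun p => p.2
  choose r hrT hr using hr
  refine Finite.Set.subset (Set.range fun p => f (r p)) ?_
  rintro _ ⟨k, hk, rfl⟩
  refine ⟨⟨φ k, k, hk, rfl⟩, ?_⟩
  have h2 : (r ⟨φ k, k, hk, rfl⟩)⁻¹ * k ∈ f.ker := h (by
    rw [MonoidHom.mem_ker, map_mul, map_inv, hr, inv_mul_cancel])
  rw [MonoidHom.mem_ker, map_mul, map_inv, inv_mul_eq_one] at h2
  exact h2

/-! ### Sections in terms of the boundary -/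

namespace Boundary

variable {E : ℕ → Type u}

theorem pre_eq_iff {y z : Boundary E} {k : ℕ} : z.pre k = y.pre k ↔ ∀ i < k, z i = y i :=
  ⟨fun h i hi => congrFun h ⟨i, hi⟩, fun h => funext fun i => h i i.2⟩

theorem pre_eq_mono {y z : Boundary E} {k l : ℕ} (hkl : k ≤ l) (h : z.pre l = y.pre l) :
    z.pre k = y.pre k :=
  pre_eq_iff.2 fun i hi => pre_eq_iff.1 h i (hi.trans_le hkl)

theorem pre_smul_eq_iff (g : TreeAut E) {y z : Boundary E} {k : ℕ} :
    (g • z).pre k = (g • y).pre k ↔ z.pre k = y.pre k := by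
  rw [pre_smul, pre_smul]
  exact (g.1 k).injective.eq_iff

theorem smul_apply_ne (g : TreeAut E) {y z : Boundary E} {k : ℕ} (h : z.pre k = y.pre k)
    (hk : z k ≠ y k) : (g • z) k ≠ (g • y) k := by
  intro h'
  have h1 : (g • z).pre (k + 1) = (g • y).pre (k + 1) := pre_eq_iff.2 fun i hi => by
    rcases Nat.lt_succ_iff_lt_or_eq.1 hi with hi | rfl
    · exact pre_eq_iff.1 ((pre_smul_eq_iff g).2 h) i hi
    · exact h'
  exact hk (pre_eq_iff.1 ((pre_smul_eq_iff g).1 h1) k k.lt_succ_self)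

theorem exists_pre_eq [∀ i, Nonempty (E i)] {k : ℕ} (v : Word E k) :
    ∃ z : Boundary E, z.pre k = v :=
  ⟨fun i => if h : i < k then v ⟨i, h⟩ else Classical.arbitrary _, funext fun i => dif_pos i.2⟩

/-- The automorphism `g` changes only the first `k` letters of the infinite words that begin with
the first `k` letters of `y`. -/
def TrivialFrom (g : TreeAut E) (k : ℕ) (y : Boundary E) : Prop :=
  ∀ z : Boundary E, z.pre k = y.pre k → ∀ i, k ≤ i → (g • z) i = z i

theorem TrivialFrom.mono {g : TreeAut E} {k l : ℕ} {y : Boundary E} (h : TrivialFrom g k y)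
    (hkl : k ≤ l) : TrivialFrom g l y :=
  fun z hz i hi => h z (pre_eq_mono hkl hz) i (hkl.trans hi)

theorem trivialFrom_one (k : ℕ) (y : Boundary E) : TrivialFrom 1 k y := fun z _ i _ => by
  rw [one_smul]

theorem TrivialFrom.mul {g h : TreeAut E} {k : ℕ} {y : Boundary E}
    (hg : TrivialFrom g k (h • y)) (hh : TrivialFrom h k y) : TrivialFrom (g * h) k y :=
  fun z hz i hi => by
    rw [mul_smul, hg _ ((pre_smul_eq_iff h).2 hz) i hi, hh z hz i hi]

theorem TrivialFrom.inv {g : TreeAut E} {k : ℕ} {y : Boundary E}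
    (hg : TrivialFrom g k y) : TrivialFrom g⁻¹ k (g • y) :=
  fun z hz i hi => by
    have h1 : (g⁻¹ • z).pre k = y.pre k := by
      rw [← pre_smul_eq_iff g, smul_inv_smul, hz]
    have h2 := hg _ h1 i hi
    rw [smul_inv_smul] at h2
    exact h2.symm

theorem section_apply_eq_one_iff [∀ i, Nonempty (E i)] (g : TreeAut E) (k m : ℕ)
    (y : Boundary E) : (TreeAut.sectionAt g (y.pre k)).1 m = 1 ↔
      ∀ z : Boundary E, z.pre k = y.pre k → ∀ j < m, (g • z) (k + j) = z (k + j) := by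
  constructor
  · intro h z hz j hj
    have h1 : z.pre (k + m) = (y.pre k).append (z.pre (k + m)).right := by
      conv_lhs => rw [← Word.append_left_right (z.pre (k + m))]
      rw [← hz]
      rfl
    have h2 : ((g • z).pre (k + m)).right = (z.pre (k + m)).right := by
      rw [pre_smul]
      conv_lhs => rw [h1]
      exact DFunLike.congr_fun h _
    exact congrFun h2 ⟨j, hj⟩
  · intro h
    refine Equiv.ext fun w => funext fun j => ?_
    obtain ⟨z, hz⟩ := exists_pre_eq ((y.pre k).append w)
    have hzl : z.pre k = y.pre k := by
      rw [← Word.left_append (y.pre k) w, ← hz]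
      rfl
    have h1 := h z hzl j j.2
    have h2 : (TreeAut.sectionAt g (y.pre k)).1 m w j = (g • z) (k + j) := by
      change (g.1 (k + m) ((y.pre k).append w)).right j = _
      rw [← hz, ← pre_smul]
      rfl
    have h3 : w j = z (k + j) := by
      rw [← Word.right_append (y.pre k) w, ← hz]
      rfl
    rw [h2, h1, ← h3]
    rfl

theorem sectionAt_eq_one_iff [∀ i, Nonempty (E i)] (g : TreeAut E) (k : ℕ) (y : Boundary E) :
    TreeAut.sectionAt g (y.pre k) = 1 ↔ TrivialFrom g k y := by
  have h : TreeAut.sectionAt g (y.pre k) = 1 ↔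
      ∀ m, (TreeAut.sectionAt g (y.pre k)).1 m = 1 :=
    ⟨fun h m => by rw [h]; rfl, fun h => Subtype.ext (funext h)⟩
  simp only [h, section_apply_eq_one_iff]
  refine ⟨fun h z hz i hi => ?_, fun h m z hz j _ => h z hz _ (Nat.le_add_right _ _)⟩
  obtain ⟨j, rfl⟩ := Nat.exists_eq_add_of_le hi
  exact h (j + 1) z hz j j.lt_succ_self

/-- Replaces iterated sections, which live over doubly shifted alphabets, by conditions on letters
of infinite words. -/
theorem finitaryOfDepthLE_sectionAt_iff [∀ i, Nonempty (E i)] (g : TreeAut E) (k m : ℕ)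
    (y : Boundary E) : TreeAut.FinitaryOfDepthLE (TreeAut.sectionAt g (y.pre k)) m ↔
      ∀ z : Boundary E, z.pre k = y.pre k → TrivialFrom g (k + m) z := by
  constructor
  · intro h z hz z' hz' i hi
    obtain ⟨j, rfl⟩ := Nat.exists_eq_add_of_le hi
    have h0 : ((z'.pre (k + (m + (j + 1)))).left : Word E k) = y.pre k := by
      rw [← hz]
      exact pre_eq_mono (Nat.le_add_right k m) hz'
    have h1 : z'.pre (k + (m + (j + 1))) =
        (y.pre k).append ((z'.pre (k + (m + (j + 1)))).right.left.append
          (z'.pre (k + (m + (j + 1)))).right.right) := by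
      rw [Word.append_left_right, ← h0, Word.append_left_right]
    have h2 : (((g • z').pre (k + (m + (j + 1)))).right.right :
        Word (shiftSeq (shiftSeq E k) m) (j + 1)) =
        (z'.pre (k + (m + (j + 1)))).right.right := by
      rw [pre_smul]
      conv_lhs => rw [h1]
      exact DFunLike.congr_fun (congrFun (congrArg Subtype.val
        (h (z'.pre (k + (m + (j + 1)))).right.left)) (j + 1)) _
    have h3 := congrFun h2 (Fin.last j)
    change (g • z') (k + (m + j)) = z' (k + (m + j)) at h3
    rwa [← Nat.add_assoc] at h3
  · intro h u
    refine Subtype.ext (funext fun l => Equiv.ext fun w => funext fun j => ?_)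
    obtain ⟨z, hz⟩ := exists_pre_eq ((y.pre k).append (u.append w))
    have hzl : z.pre k = y.pre k := by
      rw [← Word.left_append (y.pre k) (u.append w), ← hz]
      rfl
    have h1 : (g • z) (k + (m + j)) = z (k + (m + j)) := by
      rw [← Nat.add_assoc]
      exact h z hzl z rfl _ (Nat.le_add_right _ _)
    have h2 : (TreeAut.sectionAt (TreeAut.sectionAt g (y.pre k)) u).1 l w j =
        (g • z) (k + (m + j)) := by
      change (g.1 (k + (m + l)) ((y.pre k).append (u.append w))).right.right j = _
      rw [← hz, ← pre_smul]
      rfl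
    have h3 : w j = z (k + (m + j)) := by
      have h4 : w = ((y.pre k).append (u.append w)).right.right := by
        rw [Word.right_append, Word.right_append]
      rw [← hz] at h4
      exact congrFun h4 j
    rw [h2, h1, ← h3]
    rfl

theorem sectionAt_mul (g h : TreeAut E) {k : ℕ} (v : Word E k) :
    TreeAut.sectionAt (g * h) v = TreeAut.sectionAt g (h.1 k v) * TreeAut.sectionAt h v := by
  refine Subtype.ext (funext fun m => Equiv.ext fun w => ?_)
  change (g.1 (k + m) (h.1 (k + m) (v.append w))).right =
    (g.1 (k + m) ((h.1 k v).append (TreeAut.sectionFun h v m w))).right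
  rw [TreeAut.append_sectionFun]

theorem eq_one_of_forall_smul [∀ i, Nonempty (E i)] {g : TreeAut E}
    (h : ∀ y : Boundary E, g • y = y) : g = 1 := by
  refine Subtype.ext (funext fun k => Equiv.ext fun v => ?_)
  obtain ⟨y, rfl⟩ := exists_pre_eq v
  rw [← pre_smul, h]
  rfl

/-! ### Bounded activity and bounded depth -/

/-- The number of vertices of a level with non-trivial sections is bounded. -/
def HasBoundedActivity (g : TreeAut E) : Prop :=
  ∃ C : ℕ, ∀ (k : ℕ) (T : Finset (Boundary E)), (∀ z ∈ T, ¬ TrivialFrom g k z) →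
    Set.InjOn (fun z : Boundary E => z.pre k) T → T.card ≤ C

theorem hasBoundedActivity_of_isBounded [∀ i, Nonempty (E i)] [∀ i, Finite (E i)] {g : TreeAut E}
    (hg : TreeAut.IsBounded g) : HasBoundedActivity g := by
  obtain ⟨C, hC⟩ := hg
  refine ⟨C, fun k T hT hinj => le_trans ?_ (hC k)⟩
  rw [← Set.ncard_coe_finset, ← hinj.ncard_image]
  refine Set.ncard_le_ncard ?_ (Set.toFinite _)
  rintro _ ⟨z, hz, rfl⟩
  exact fun h => hT z hz ((sectionAt_eq_one_iff g k z).1 h)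

/-- Along every infinite word, the sections at the vertices next to this word are eventually
finitary of depth at most `n`. -/
def HasDepthBound (n : ℕ) (g : TreeAut E) : Prop :=
  ∀ y : Boundary E, ∃ k₀, ∀ k ≥ k₀, ∀ z : Boundary E, z.pre k = y.pre k → z k ≠ y k →
    TrivialFrom g (k + 1 + n) z

/-- The automorphisms with bounded activity. -/
def boundedActivity (E : ℕ → Type u) : Subgroup (TreeAut E) where
  carrier := {g | HasBoundedActivity g}
  one_mem' := ⟨0, fun k T hT _ => by
    rw [Finset.eq_empty_of_forall_notMem fun z hz => hT z hz (trivialFrom_one k z),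
      Finset.card_empty]⟩
  mul_mem' := by
    classical
    rintro g h ⟨C, hC⟩ ⟨D, hD⟩
    refine ⟨D + C, fun k T hT hinj => ?_⟩
    rw [← Finset.card_filter_add_card_filter_not (s := T) fun z => ¬ TrivialFrom h k z]
    refine add_le_add (hD k _ (fun z hz => (Finset.mem_filter.1 hz).2)
      (hinj.mono (Finset.filter_subset _ _))) ?_
    rw [← Finset.card_image_of_injective _ (MulAction.injective h)]
    refine hC k _ (fun z hz => ?_) ?_
    · obtain ⟨y, hy, rfl⟩ := Finset.mem_image.1 hz
      rw [Finset.mem_filter, not_not] at hy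
      exact fun hg => hT y hy.1 (hg.mul hy.2)
    · rw [Finset.coe_image]
      rintro _ ⟨y, hy, rfl⟩ _ ⟨z, hz, rfl⟩ hyz
      exact congrArg _ (hinj (Finset.mem_filter.1 hy).1 (Finset.mem_filter.1 hz).1
        ((pre_smul_eq_iff h).1 hyz))
  inv_mem' := by
    classical
    rintro g ⟨C, hC⟩
    refine ⟨C, fun k T hT hinj => ?_⟩
    rw [← Finset.card_image_of_injective _ (MulAction.injective g⁻¹)]
    refine hC k _ (fun z hz => ?_) ?_
    · obtain ⟨y, hy, rfl⟩ := Finset.mem_image.1 hz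
      intro h
      have := h.inv
      rw [smul_inv_smul] at this
      exact hT y hy this
    · rw [Finset.coe_image]
      rintro _ ⟨y, hy, rfl⟩ _ ⟨z, hz, rfl⟩ hyz
      exact congrArg _ (hinj hy hz ((pre_smul_eq_iff g⁻¹).1 hyz))

/-- The automorphisms whose depth is bounded by `n` along every infinite word. -/
def depthBound (E : ℕ → Type u) (n : ℕ) : Subgroup (TreeAut E) where
  carrier := {g | HasDepthBound n g}
  one_mem' := fun _ => ⟨0, fun _ _ _ _ _ => trivialFrom_one _ _⟩
  mul_mem' := by
    intro g h hg hh y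
    obtain ⟨k, hk⟩ := hg (h • y)
    obtain ⟨l, hl⟩ := hh y
    refine ⟨max k l, fun m hm z hz hzm => ?_⟩
    exact (hk m (le_of_max_le_left hm) _ ((pre_smul_eq_iff h).2 hz) (smul_apply_ne h hz hzm)).mul
      (hl m (le_of_max_le_right hm) z hz hzm)
  inv_mem' := by
    intro g hg y
    obtain ⟨k, hk⟩ := hg (g⁻¹ • y)
    refine ⟨k, fun m hm z hz hzm => ?_⟩
    have := (hk m hm _ ((pre_smul_eq_iff g⁻¹).2 hz) (smul_apply_ne g⁻¹ hz hzm)).inv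
    rwa [smul_inv_smul] at this

theorem depthBound_mono : Monotone (depthBound E) := fun n m hnm g hg y => by
  obtain ⟨k, hk⟩ := hg y
  exact ⟨k, fun l hl z hz hzl => (hk l hl z hz hzl).mono (by omega)⟩

theorem eventually_injOn_pre (T : Finset (Boundary E)) :
    ∀ᶠ k in Filter.atTop, Set.InjOn (fun z : Boundary E => z.pre k) T := by
  simp only [Set.InjOn]
  have h : ∀ᶠ k in Filter.atTop, ∀ y ∈ T, ∀ z ∈ T, y.pre k = z.pre k → y = z := by
    rw [Filter.eventually_all_finset]
    intro y _
    rw [Filter.eventually_all_finset]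
    intro z _
    by_cases hyz : y = z
    · exact Filter.Eventually.of_forall fun _ _ => hyz
    · obtain ⟨i, hi⟩ := Function.ne_iff.1 hyz
      filter_upwards [Filter.eventually_gt_atTop i] with k hk h
      exact absurd (pre_eq_iff.1 h i hk) hi
  filter_upwards [h] with k hk y hy z hz hyz using hk y hy z hz hyz

/-- Finitely many distinct words have distinct beginnings at a deep level, where each singular one
gives a nontrivial section. -/
theorem finite_singular {g : TreeAut E} (hg : g ∈ boundedActivity E) :
    {y : Boundary E | ∀ k, ¬ TrivialFrom g k y}.Finite := by
  obtain ⟨C, hC⟩ := hg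
  by_contra h
  obtain ⟨T, hT, hcard⟩ := Set.Infinite.exists_subset_card_eq h (C + 1)
  obtain ⟨k, hk⟩ := (eventually_injOn_pre T).exists
  have := hC k T (fun z hz => hT hz k) hk
  omega

/-- Bounded activity leaves only finitely many levels at which a branch off `y` has a non-finitary
section; elsewhere the hypothesis bounds the depth. -/
theorem exists_hasDepthBound [∀ i, Nonempty (E i)] {g : TreeAut E} (hg : g ∈ boundedActivity E)
    {n : ℕ} (h : ∀ (k : ℕ) (v : Word E k), TreeAut.IsFinitary (TreeAut.sectionAt g v) →
      TreeAut.depth (TreeAut.sectionAt g v) < n) : g ∈ depthBound E n := by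
  classical
  obtain ⟨C, hC⟩ := hg
  intro y
  suffices hfin : ∃ k₀, ∀ k ≥ k₀, ∀ z : Boundary E, z.pre k = y.pre k → z k ≠ y k →
      TreeAut.IsFinitary (TreeAut.sectionAt g (z.pre (k + 1))) by
    obtain ⟨k₀, hk₀⟩ := hfin
    refine ⟨k₀, fun k hk z hz hzk => ?_⟩
    have h1 := hk₀ k hk z hz hzk
    have h2 : TreeAut.FinitaryOfDepthLE (TreeAut.sectionAt g (z.pre (k + 1)))
        (TreeAut.depth (TreeAut.sectionAt g (z.pre (k + 1)))) := Nat.sInf_mem h1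
    exact ((finitaryOfDepthLE_sectionAt_iff g (k + 1) _ z).1 h2 z rfl).mono
      (Nat.add_le_add_left (h _ _ h1).le _)
  by_contra hcon
  push Not at hcon
  let K : Set ℕ := {k | ∀ N > k, ∃ z : Boundary E, z.pre k = y.pre k ∧ z k ≠ y k ∧
    ¬ TrivialFrom g N z}
  have hK : K.Infinite := Set.infinite_of_forall_exists_gt fun k₀ => by
    obtain ⟨k, hk, z, hz, hzk, hnf⟩ := hcon (k₀ + 1)
    refine ⟨k, fun N hN => ?_, hk⟩
    by_contra hall
    push Not at hall
    refine hnf ⟨N - (k + 1), (finitaryOfDepthLE_sectionAt_iff g (k + 1) _ z).2 fun z' hz' => ?_⟩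
    rw [Nat.add_sub_of_le hN]
    refine hall z' ((pre_eq_mono (Nat.le_succ k) hz').trans hz) ?_
    rw [pre_eq_iff.1 hz' k k.lt_succ_self]
    exact hzk
  -- Words leaving `y` at C + 1 different levels have distinct beginnings at any common deeper
  -- level, where each can be chosen to have a nontrivial section.
  obtain ⟨K', hK', hcard⟩ := hK.exists_subset_card_eq (C + 1)
  have hN : ∀ k ∈ K', K'.sup id + 1 > k := fun k hk =>
    Nat.lt_succ_of_le (Finset.le_sup (f := id) hk)
  have hz : ∀ k : K', ∃ z : Boundary E, z.pre k = y.pre k ∧ z k ≠ y k ∧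
      ¬ TrivialFrom g (K'.sup id + 1) z := fun k => hK' k.2 _ (hN k k.2)
  choose z hzpre hzne hznt using hz
  have hinj : ∀ k l : K', (z k).pre (K'.sup id + 1) = (z l).pre (K'.sup id + 1) → k = l := by
    have hlt : ∀ k l : K', (k : ℕ) < l →
        (z k).pre (K'.sup id + 1) ≠ (z l).pre (K'.sup id + 1) := fun k l hkl heq =>
      hzne k ((pre_eq_iff.1 heq k (hN k k.2)).trans (pre_eq_iff.1 (hzpre l) k hkl))
    intro k l heq
    rcases lt_trichotomy (k : ℕ) l with hkl | hkl | hkl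
    · exact absurd heq (hlt k l hkl)
    · exact Subtype.ext hkl
    · exact absurd heq.symm (hlt l k hkl)
  have hle := hC (K'.sup id + 1) (Finset.univ.image z)
    (fun x hx => by
      obtain ⟨k, _, rfl⟩ := Finset.mem_image.1 hx
      exact hznt k)
    (fun x hx x' hx' hxx' => by
      obtain ⟨k, _, rfl⟩ := Finset.mem_image.1 (Finset.mem_coe.1 hx)
      obtain ⟨l, _, rfl⟩ := Finset.mem_image.1 (Finset.mem_coe.1 hx')
      exact congrArg z (hinj k l hxx'))
  rw [Finset.card_image_of_injective _ fun k l hkl => hinj k l (by rw [hkl]), Finset.card_univ,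
    Fintype.card_coe, hcard] at hle
  omega

end Boundary

namespace Boundary

variable {E : ℕ → Type u}

/-! ### The cocycle of eventual actions of sections on finite levels -/

section GermCocycle

variable {M n : ℕ} (ι : ∀ k, Word (shiftSeq E k) (n + 1) ↪ Fin M)

/-- The germ at infinity of the sequence of the actions of the sections of `g` along `y` on the
words of length `n + 1`. -/
noncomputable def germVal (g : TreeAut E) (y : Boundary E) :
    Filter.Germ (Filter.atTop : Filter ℕ) (Equiv.Perm (Fin M)) :=
  ((fun k => Equiv.Perm.viaEmbeddingHom (ι k) ((TreeAut.sectionAt g (y.pre k)).1 (n + 1)) :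
    ℕ → Equiv.Perm (Fin M)) : Filter.Germ (Filter.atTop : Filter ℕ) (Equiv.Perm (Fin M)))

theorem germVal_mul (g h : TreeAut E) (y : Boundary E) :
    germVal ι (g * h) y = germVal ι g (h • y) * germVal ι h y := by
  refine congrArg (fun f : ℕ → Equiv.Perm (Fin M) =>
    (f : Filter.Germ (Filter.atTop : Filter ℕ) (Equiv.Perm (Fin M)))) (funext fun k => ?_)
  beta_reduce
  rw [sectionAt_mul, ← map_mul, pre_smul]
  rfl

/-- For a word leaving y at a late level k, triviality of the germ controls the letters up to k + n,
and the depth bound controls those from k + 1 + n on. This is why blocks of length n + 1 suffice. -/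
theorem germVal_eq_one_iff [∀ i, Nonempty (E i)] {g : TreeAut E} (hg : g ∈ depthBound E n)
    (y : Boundary E) : germVal ι g y = 1 ↔ ∃ k, TrivialFrom g k y := by
  have h1 : germVal ι g y = 1 ↔ ∀ᶠ k in Filter.atTop,
      (TreeAut.sectionAt g (y.pre k)).1 (n + 1) = 1 := by
    rw [germVal, ← Filter.Germ.coe_one, Filter.Germ.coe_eq]
    refine Filter.eventually_congr (Filter.Eventually.of_forall fun k => ?_)
    rw [Pi.one_apply, map_eq_one_iff _ (Equiv.Perm.viaEmbeddingHom_injective (ι k))]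
  rw [h1]
  constructor
  · intro h
    obtain ⟨k₀, hk₀⟩ := Filter.eventually_atTop.1 h
    obtain ⟨k₁, hk₁⟩ := hg y
    refine ⟨max k₀ k₁, fun z hz => ?_⟩
    have hloc : ∀ k ≥ max k₀ k₁, z.pre k = y.pre k → ∀ j < n + 1, (g • z) (k + j) = z (k + j) :=
      fun k hk hzk =>
        (section_apply_eq_one_iff g k (n + 1) y).1 (hk₀ k (le_of_max_le_left hk)) z hzk
    have hagree : ∀ k ≥ max k₀ k₁, z.pre k = y.pre k → ∀ i, max k₀ k₁ ≤ i → i < k + (n + 1) →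
        (g • z) i = z i := fun k hk hzk i hi hik => by
      -- While still on `y`, the section at level i controls its first letter; past k, the section
      -- at level k controls n + 1 letters.
      rcases lt_or_ge i k with h' | h'
      · exact hloc i hi (pre_eq_mono h'.le hzk) 0 n.succ_pos
      · obtain ⟨j, rfl⟩ := Nat.exists_eq_add_of_le h'
        exact hloc k hk hzk j (by omega)
    intro i hi
    by_cases hzi : z.pre i = y.pre i
    · exact hagree i hi hzi i hi (by omega)
    · obtain ⟨k, hk, hzk, hne⟩ : ∃ k ≥ max k₀ k₁, z.pre k = y.pre k ∧ z k ≠ y k := by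
        classical
        have hex : ∃ k, z k ≠ y k := by
          by_contra hall
          push Not at hall
          exact hzi (pre_eq_iff.2 fun j _ => hall j)
        refine ⟨Nat.find hex, ?_, pre_eq_iff.2 fun j hj => not_not.1 (Nat.find_min hex hj),
          Nat.find_spec hex⟩
        by_contra hlt
        exact Nat.find_spec hex (pre_eq_iff.1 hz _ (not_le.1 hlt))
      rcases lt_or_ge i (k + (n + 1)) with h' | h'
      · exact hagree k hk hzk i hi h'
      · exact hk₁ k (le_of_max_le_right hk) z hzk hne z rfl i (by omega)
  · rintro ⟨k, hk⟩
    filter_upwards [Filter.eventually_ge_atTop k] with l hl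
    rw [(sectionAt_eq_one_iff g l y).2 (hk.mono hl)]
    rfl

/-- The cocycle `germVal` on a group of automorphisms with bounded activity and depth. -/
noncomputable def germCocycle [∀ i, Nonempty (E i)] (Γ : Subgroup (TreeAut E))
    (hΓ : Γ ≤ boundedActivity E ⊓ depthBound E n) :
    FinCocycle Γ (Boundary E) (Filter.Germ (Filter.atTop : Filter ℕ) (Equiv.Perm (Fin M))) where
  val g y := germVal ι (g : TreeAut E) y
  val_mul g h y := germVal_mul ι _ _ y
  finite_support g := by
    refine (finite_singular (hΓ g.2).1).subset fun y hy k hk => hy ?_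
    exact (germVal_eq_one_iff ι (hΓ g.2).2 y).2 ⟨k, hk⟩

end GermCocycle

/-- Here bounded alphabets enter: blocks at all depths fit into one finite set, giving the cocycle a
single finite group of coordinate values. -/
theorem exists_embedding_fin [∀ i, Finite (E i)] (hE : ∃ C : ℕ, ∀ i, Nat.card (E i) ≤ C) (m : ℕ) :
    ∃ M : ℕ, ∀ k, Nonempty (Word (shiftSeq E k) m ↪ Fin M) := by
  obtain ⟨C, hC⟩ := hE
  have h : ∀ i, Nonempty (E i ↪ Fin C) := fun i =>
    ⟨(Finite.equivFin (E i)).toEmbedding.trans (Fin.castLEEmb (hC i))⟩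
  refine ⟨Fintype.card (Fin m → Fin C), fun k => ⟨Function.Embedding.trans
    (Function.Embedding.piCongrRight fun i => (h (k + i)).some)
    (Fintype.equivFin (Fin m → Fin C)).toEmbedding⟩⟩

/-! ### Groups of finitary automorphisms -/

theorem finite_trivialFrom [∀ i, Nonempty (E i)] [∀ i, Finite (E i)] (k : ℕ) :
    {g : TreeAut E | ∀ y, TrivialFrom g k y}.Finite := by
  have h : Set.InjOn (fun g : TreeAut E => g.1 k) {g | ∀ y, TrivialFrom g k y} := by
    intro g hg h hh hgh
    have hsmul : ∀ y : Boundary E, g • y = h • y := fun y => funext fun i => by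
      rcases lt_or_ge i k with hi | hi
      · have h1 : (g • y).pre k = (h • y).pre k := by
          rw [pre_smul, pre_smul]
          exact DFunLike.congr_fun hgh _
        exact pre_eq_iff.1 h1 i hi
      · rw [hg y y rfl i hi, hh y y rfl i hi]
    have h1 : h⁻¹ * g = 1 := eq_one_of_forall_smul fun y => by
      rw [mul_smul, hsmul, inv_smul_smul]
    exact (inv_mul_eq_one.1 h1).symm
  exact Set.Finite.of_finite_image (Set.toFinite _) h

/-- A pointwise finitary automorphism is finitary. -/
theorem exists_forall_trivialFrom [∀ i, Finite (E i)] {g : TreeAut E}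
    (h : ∀ y : Boundary E, ∃ k, TrivialFrom g k y) : ∃ k, ∀ y : Boundary E, TrivialFrom g k y := by
  let _ : ∀ i, TopologicalSpace (E i) := fun _ => ⊥
  have : ∀ i, DiscreteTopology (E i) := fun _ => ⟨rfl⟩
  have : CompactSpace (Boundary E) := inferInstanceAs (CompactSpace (∀ i, E i))
  have hopen : ∀ k, IsOpen {y : Boundary E | TrivialFrom g k y} := fun k => by
    have hc : Continuous fun y : Boundary E => y.pre k :=
      continuous_pi fun j => continuous_apply (A := E) (j : ℕ)
    have : {y : Boundary E | TrivialFrom g k y} =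
        (fun y : Boundary E => y.pre k) ⁻¹' {v | ∃ y : Boundary E, y.pre k = v ∧
          TrivialFrom g k y} := by
      ext y
      refine ⟨fun hy => ⟨y, rfl, hy⟩, ?_⟩
      rintro ⟨z, hz, hgz⟩ w hw
      exact hgz w (hw.trans hz.symm)
    rw [this]
    exact (isOpen_discrete _).preimage hc
  -- The boundary is compact and is covered by the increasing open sets on which the section at
  -- level k is trivial.
  obtain ⟨k, hk⟩ := isCompact_univ.elim_directed_cover _ hopen
    (fun y _ => Set.mem_iUnion.2 (h y))
    (directed_of_isDirected_le fun k l hkl y hy => TrivialFrom.mono hy hkl)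
  exact ⟨k, fun y => hk (Set.mem_univ y)⟩

/-- Finitely many generators share a level k, and automorphisms changing only the first k letters
are determined by their action on that level. -/
theorem isLocallyFiniteGroup_of_trivialFrom [∀ i, Nonempty (E i)] [∀ i, Finite (E i)]
    {Γ : Subgroup (TreeAut E)} (h : ∀ g ∈ Γ, ∀ y : Boundary E, ∃ k, TrivialFrom g k y) :
    IsLocallyFiniteGroup Γ := by
  intro H hH
  obtain ⟨T, rfl, hT⟩ := (Subgroup.fg_iff H).1 hH
  choose! K hK using fun g : Γ => exists_forall_trivialFrom (h g g.2)
  obtain ⟨k, hk⟩ := (hT.image K).bddAbove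
  let D : Subgroup Γ :=
    { carrier := {g | ∀ y : Boundary E, TrivialFrom (g : TreeAut E) k y}
      one_mem' := fun y => trivialFrom_one k y
      mul_mem' := fun {a b} ha hb y => (ha _).mul (hb y)
      inv_mem' := fun {a} ha y => by
        have := (ha ((a : TreeAut E)⁻¹ • y)).inv
        rwa [smul_inv_smul] at this }
  have hD : (D : Set Γ).Finite :=
    (finite_trivialFrom (E := E) k).preimage (f := fun g : Γ => (g : TreeAut E))
      Subtype.val_injective.injOn
  have hle : Subgroup.closure T ≤ D := (Subgroup.closure_le _).2 fun g hg y =>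
    (hK g y).mono (hk ⟨g, hg, rfl⟩)
  exact hD.subset hle

/-! ### Recurrence of the action on the boundary -/

theorem isRecurrentAction [∀ i, Finite (E i)] (Γ : Subgroup (TreeAut E))
    (hΓ : Γ ≤ boundedActivity E) : IsRecurrentAction Γ (Boundary E) := by
  classical
  intro S F ε hε
  let S' : Finset Γ := S ∪ S.image fun s => s⁻¹
  have hS' : ∀ s ∈ S', s⁻¹ ∈ S' := fun s hs => by
    rcases Finset.mem_union.1 hs with h | h
    · exact Finset.mem_union_right _ (Finset.mem_image_of_mem _ h)
    · obtain ⟨t, ht, rfl⟩ := Finset.mem_image.1 h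
      rw [inv_inv]
      exact Finset.mem_union_left _ ht
  -- Images of singular points are added, so that a generator sends a point either into `P` or, at a
  -- nonsingular point, to a word with the same tail.
  let P : Finset (Boundary E) := F ∪ S'.biUnion fun s =>
    (finite_singular (hΓ s.2)).toFinset.image fun y => s • y
  have htail : ∀ k : ℕ, {y : Boundary E | ∃ p ∈ P, ∀ i ≥ k, y i = p i}.Finite := fun k => by
    let f : Word E k × P → Boundary E := fun a i => if h : i < k then a.1 ⟨i, h⟩ else a.2.1 i
    refine (Set.finite_range f).subset ?_
    rintro y ⟨p, hp, hy⟩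
    refine ⟨(y.pre k, ⟨p, hp⟩), funext fun i => ?_⟩
    by_cases hi : i < k
    · exact dif_pos hi
    · exact (dif_neg hi).trans (hy i (not_lt.1 hi)).symm
  let A : ℕ → Finset (Boundary E) := fun k => (htail k).toFinset
  have hA : ∀ k y, y ∈ A k ↔ ∃ p ∈ P, ∀ i ≥ k, y i = p i := fun k y => Set.Finite.mem_toFinset _
  have hAmono : Monotone A := fun k l hkl y hy => by
    obtain ⟨p, hp, h⟩ := (hA k y).1 hy
    exact (hA l y).2 ⟨p, hp, fun i hi => h i (le_trans hkl hi)⟩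
  have hPA : P ⊆ A 0 := fun p hp => (hA 0 p).2 ⟨p, hp, fun _ _ => rfl⟩
  have hstay : ∀ s : Γ, ∀ k y, y ∈ A k → TrivialFrom (s : TreeAut E) k y → s • y ∈ A k :=
    fun s k y hy hs => by
      obtain ⟨p, hp, h⟩ := (hA k y).1 hy
      exact (hA k _).2 ⟨p, hp, fun i hi => (hs y rfl i hi).trans (h i hi)⟩
  have hex : ∀ s ∈ S', ∀ k, ∃ l, ∀ x ∈ A k, s • x ∈ A l := by
    intro s hs k
    have hx : ∀ x ∈ A k, ∀ᶠ l in Filter.atTop, s • x ∈ A l := by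
      intro x hx
      by_cases hsing : ∀ l, ¬ TrivialFrom (s : TreeAut E) l x
      · refine Filter.Eventually.of_forall fun l => hAmono (Nat.zero_le l) (hPA ?_)
        refine Finset.mem_union_right _ (Finset.mem_biUnion.2 ⟨s, hs, ?_⟩)
        exact Finset.mem_image_of_mem _ ((Set.Finite.mem_toFinset _).2 hsing)
      · push Not at hsing
        obtain ⟨l, hl⟩ := hsing
        filter_upwards [Filter.eventually_ge_atTop k, Filter.eventually_ge_atTop l] with m hkm hlm
        exact hstay s m x (hAmono hkm hx) (hl.mono hlm)
    exact ((Filter.eventually_all_finset (A k)).2 hx).exists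
  have hbd : ∀ s ∈ S', ∃ C : ℕ, ∀ k, {x | x ∈ A k ∧ s • x ∉ A k}.ncard ≤ C := by
    intro s _
    obtain ⟨C, hC⟩ := hΓ s.2
    -- A point leaving `A k` has a nontrivial section at level k, and points with the same tail
    -- after k are told apart by their beginnings: at most C for each tail from `P`.
    refine ⟨P.card * C, fun k => ?_⟩
    let B : Boundary E → Finset (Boundary E) := fun p =>
      (A k).filter fun x => s • x ∉ A k ∧ ∀ i ≥ k, x i = p i
    have hsub : {x | x ∈ A k ∧ s • x ∉ A k} ⊆ (P.biUnion B : Set (Boundary E)) := by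
      rintro x ⟨hx, hsx⟩
      obtain ⟨p, hp, h⟩ := (hA k x).1 hx
      exact Finset.mem_biUnion.2 ⟨p, hp, Finset.mem_filter.2 ⟨hx, hsx, h⟩⟩
    refine (Set.ncard_le_ncard hsub (Finset.finite_toSet _)).trans ?_
    rw [Set.ncard_coe_finset]
    refine Finset.card_biUnion_le_card_mul _ _ _ fun p _ => hC k _ (fun z hz hs => ?_) ?_
    · obtain ⟨hz, hsz, _⟩ := Finset.mem_filter.1 hz
      exact hsz (hstay s k z hz hs)
    · intro x hx y hy hxy
      obtain ⟨_, _, hx⟩ := Finset.mem_filter.1 (Finset.mem_coe.1 hx)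
      obtain ⟨_, _, hy⟩ := Finset.mem_filter.1 (Finset.mem_coe.1 hy)
      refine funext fun i => ?_
      rcases lt_or_ge i k with hi | hi
      · exact pre_eq_iff.1 hxy i hi
      · rw [hx i hi, hy i hi]
  obtain ⟨a, ha0, ha1, haS⟩ :=
    exists_smallEnergy_of_bounded_boundary S' hS' A hAmono hex hbd hε
  exact ⟨a, ha0, fun x hx => ha1 x (hPA (Finset.mem_union_left _ hx)),
    fun s hs => haS s (Finset.mem_union_left _ hs)⟩

theorem isReiterAction_of_le [∀ i, Nonempty (E i)] [∀ i, Finite (E i)]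
    (hE : ∃ C : ℕ, ∀ i, Nat.card (E i) ≤ C) {n : ℕ} (Γ : Subgroup (TreeAut E))
    (hΓ : Γ ≤ boundedActivity E ⊓ depthBound E n) : IsReiterAction Γ Γ := by
  obtain ⟨M, hM⟩ := exists_embedding_fin hE (n + 1)
  let c := germCocycle (fun k => (hM k).some) Γ hΓ
  refine c.isReiterAction (isLocallyFiniteGroup_germ _ _)
    (isRecurrentAction Γ fun g hg => (hΓ hg).1) ?_
  have h1 : IsLocallyFiniteGroup (c.ker.map Γ.subtype) := by
    refine isLocallyFiniteGroup_of_trivialFrom ?_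
    rintro _ ⟨g, hg, rfl⟩ y
    exact (germVal_eq_one_iff (fun k => (hM k).some) (hΓ g.2).2 y).1 (hg y)
  exact h1.of_injective (c.ker.equivMapOfInjective _ Γ.subtype_injective).toMonoidHom
    (MulEquiv.injective _)

/-! ### Groups of germs -/

theorem mem_trivialGerms_of_trivialFrom (G : Subgroup (TreeAut E)) {w : Boundary E}
    {g : MulAction.stabilizer G w} {k : ℕ} (h : TrivialFrom ((g : G) : TreeAut E) k w) :
    g ∈ trivialGerms G w := by
  let _ : ∀ i, TopologicalSpace (E i) := fun _ => ⊥
  have : ∀ i, DiscreteTopology (E i) := fun _ => ⟨rfl⟩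
  have hc : Continuous fun y : Boundary E => y.pre k :=
    continuous_pi fun j => continuous_apply (A := E) (j : ℕ)
  have hU : ∀ᶠ z in 𝓝 w, z.pre k = w.pre k :=
    ((isOpen_discrete {w.pre k}).preimage hc).mem_nhds rfl
  filter_upwards [hU] with z hz
  have hw : ((g : G) : TreeAut E) • w = w := g.2
  refine funext fun i => ?_
  rcases lt_or_ge i k with hi | hi
  · have h1 := (pre_smul_eq_iff ((g : G) : TreeAut E)).2 hz
    rw [hw, ← hz] at h1
    exact pre_eq_iff.1 h1 i hi
  · exact h z hz i hi

/-- Lifts of finitely many germs share a depth bound n. On the stabilizer of `w` inside that group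
the cocycle at `w` is a homomorphism to a locally finite group, and its kernel has trivial germs. -/
theorem isLocallyFiniteGroup_germGroup [∀ i, Nonempty (E i)] [∀ i, Finite (E i)]
    (hE : ∃ C : ℕ, ∀ i, Nat.card (E i) ≤ C) (G : Subgroup (TreeAut E))
    (hG : ∀ g ∈ G, ∃ n, g ∈ depthBound E n) (w : Boundary E) :
    IsLocallyFiniteGroup (GermGroup G w) := by
  intro H hH
  obtain ⟨T, rfl, hT⟩ := (Subgroup.fg_iff H).1 hH
  choose r hr using QuotientGroup.mk'_surjective (trivialGerms G w)
  choose! N hN using hG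
  obtain ⟨n, hn⟩ := (hT.image fun t => N ((r t : G) : TreeAut E)).bddAbove
  obtain ⟨M, hM⟩ := exists_embedding_fin hE (n + 1)
  let K : Subgroup (MulAction.stabilizer G w) :=
    (depthBound E n).comap (G.subtype.comp (MulAction.stabilizer G w).subtype)
  have hK : ∀ t ∈ T, r t ∈ K := fun t ht =>
    depthBound_mono (hn ⟨t, ht, rfl⟩) (hN _ (r t : G).2)
  let φ : K →* Filter.Germ (Filter.atTop : Filter ℕ) (Equiv.Perm (Fin M)) :=
    MonoidHom.mk' (fun g => germVal (fun k => (hM k).some)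
      (((g : MulAction.stabilizer G w) : G) : TreeAut E) w) fun g h => by
        have hw : (((h : MulAction.stabilizer G w) : G) : TreeAut E) • w = w :=
          (h : MulAction.stabilizer G w).2
        have := germVal_mul (fun k => (hM k).some)
          (((g : MulAction.stabilizer G w) : G) : TreeAut E)
          (((h : MulAction.stabilizer G w) : G) : TreeAut E) w
        rwa [hw] at this
  let f : K →* GermGroup G w := (QuotientGroup.mk' (trivialGerms G w)).comp K.subtype
  have hker : φ.ker ≤ f.ker := fun g hg => by
    obtain ⟨k, hk⟩ := (germVal_eq_one_iff (fun k => (hM k).some) g.2 w).1 hg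
    exact (QuotientGroup.eq_one_iff _).2 (mem_trivialGerms_of_trivialFrom G hk)
  have hfin := (isLocallyFiniteGroup_germ (Filter.atTop : Filter ℕ)
    (Equiv.Perm (Fin M))).of_ker_le f φ hker (T := K.subtype ⁻¹' (r '' T))
    ((hT.image r).preimage K.subtype_injective.injOn)
  rw [MonoidHom.map_closure] at hfin
  have hT' : f '' (K.subtype ⁻¹' (r '' T)) = T := by
    ext t
    constructor
    · rintro ⟨g, ⟨t', ht', hg⟩, rfl⟩
      have : f g = t' := by
        change QuotientGroup.mk' (trivialGerms G w) (K.subtype g) = t'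
        rw [← hg, hr]
      rwa [this]
    · exact fun ht => ⟨⟨r t, hK t ht⟩, ⟨t, ht, rfl⟩, hr t⟩
  rwa [hT'] at hfin

end Boundary

/-! ### Empty alphabets and the main theorem -/

theorem TreeAut.finite_of_isEmpty {E : ℕ → Type u} [∀ i, Finite (E i)] {i : ℕ}
    (hi : IsEmpty (E i)) : Finite (TreeAut E) := by
  refine Finite.of_injective
    (fun (g : TreeAut E) (k : Fin (i + 1)) => g.1 k) fun g h hgh => ?_
  refine Subtype.ext (funext fun k => Equiv.ext fun v => ?_)
  rcases lt_or_ge k (i + 1) with hk | hk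
  · exact DFunLike.congr_fun (congrFun hgh ⟨k, hk⟩) v
  · exact hi.elim (v ⟨i, hk⟩)

open Boundary in
theorem mainTheorem5 {E : ℕ → Type u} [∀ i, Finite (E i)]
    (hE : ∃ C : ℕ, ∀ i, Nat.card (E i) ≤ C)
    (G : Subgroup (TreeAut E)) (S : Set (TreeAut E)) (hS : Subgroup.closure S = G)
    (hbdd : ∀ g ∈ S, TreeAut.IsBounded g)
    (hdepth : ∀ g ∈ S, ∃ n : ℕ, ∀ (k : ℕ) (v : Word E k),
      TreeAut.IsFinitary (TreeAut.sectionAt g v) → TreeAut.depth (TreeAut.sectionAt g v) < n) :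
    (∀ w : Boundary E, IsLocallyFiniteGroup (GermGroup G w)) ∧ IsAmenableGroup G := by
  classical
  -- With nonempty alphabets every vertex begins some infinite word, so sections can be read on the
  -- boundary. Otherwise the tree has finitely many nonempty levels, its automorphism group is
  -- finite and its boundary is empty.
  by_cases hne : ∀ i, Nonempty (E i)
  · have hGb : G ≤ boundedActivity E := by
      rw [← hS, Subgroup.closure_le]
      exact fun g hg => hasBoundedActivity_of_isBounded (hbdd g hg)
    have hGd : G ≤ ⨆ n, depthBound E n := by
      rw [← hS, Subgroup.closure_le]
      intro g hg
      obtain ⟨n, hn⟩ := hdepth g hg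
      exact le_iSup (depthBound E) n
        (exists_hasDepthBound (hasBoundedActivity_of_isBounded (hbdd g hg)) hn)
    have hGd' : ∀ g ∈ G, ∃ n, g ∈ depthBound E n := fun g hg =>
      (Subgroup.mem_iSup_of_directed depthBound_mono.directed_le).1 (hGd hg)
    refine ⟨fun w => isLocallyFiniteGroup_germGroup hE G hGd' w,
      IsReiterAction.isAmenableAction fun T ε hε => ?_⟩
    choose N hN using fun g : G => hGd' g g.2
    let n := T.sup N
    -- A subgroup with one depth bound containing the given finite set; its almost invariant measure
    -- is then pushed forward to `G`.
    let Γ : Subgroup (TreeAut E) := G ⊓ depthBound E n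
    have hΓ : IsReiterAction Γ Γ :=
      isReiterAction_of_le hE Γ (inf_le_inf_right _ hGb)
    have hT : ∀ s ∈ T, (s : TreeAut E) ∈ Γ := fun s hs =>
      ⟨s.2, depthBound_mono (Finset.le_sup hs) (hN s)⟩
    let j : T → Γ := fun s => ⟨(s.1 : TreeAut E), hT s.1 s.2⟩
    obtain ⟨p, hp, hpT⟩ := hΓ (T.attach.image j) ε hε
    let i : Γ →* G := Subgroup.inclusion inf_le_left
    refine ⟨mapDomain i p, hp.mapDomain i, fun s hs => ?_⟩
    have h1 := hpT ⟨(s : TreeAut E), hT s hs⟩ (Finset.mem_image.2 ⟨⟨s, hs⟩, Finset.mem_attach _ _, rfl⟩)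
    have h2 : mapDomain (fun x => s • x) (mapDomain i p) =
        mapDomain i (mapDomain (fun x => (⟨(s : TreeAut E), hT s hs⟩ : Γ) • x) p) := by
      rw [← mapDomain_comp, ← mapDomain_comp]
      rfl
    rw [h2, ← mapDomain_sub]
    refine le_trans ?_ h1
    exact l1_mapDomain_le _ _
  · rw [not_forall] at hne
    obtain ⟨i, hi⟩ := hne
    rw [not_nonempty_iff] at hi
    have := TreeAut.finite_of_isEmpty hi
    refine ⟨fun w => hi.elim (w i), IsReiterAction.isAmenableAction ?_⟩
    exact IsLocallyFiniteGroup.isReiterAction fun H _ => inferInstance
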